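/- **Setting.** Let $\mathbb X$ be a connected metric space with metric $\rho$, $\mathbb B(x,r)=\{y:\rho(x,y)\le r\}$, and $C_0(\mathbb X)$ the real continuous functions on $\mathbb X$ vanishing at infinity. Let $\mu^*$ be a positive $\sigma$-finite Borel measure on $\mathbb X$, $0=\lambda_0\le\lambda_1\le\cdots$ with $\lambda_k\to\infty$, and let $\{\phi_k\}_{k\ge 0}\subset L^1(\mu^*)\cap C_0(\mathbb X)$ be orthonormal in $L^2(\mu^*)$ with $\phi_0>0$ everywhere. Put $\Pi_n=\mathrm{span}\{\phi_k:\lambda_k<n\}$ and suppose that $\bigcup_n\Pi_n$ is dense in $C_0(\mathbb X)$. Let $\|\cdot\|_\infty$ be the $\mu^*$-essential supremum norm. Assume that $\Xi=(\mathbb X,\rho,\mu^*,\{\lambda_k\},\{\phi_k\})$ is a *data space*, i.e., for some real $q\ge1$ and $\kappa,\kappa_1,\kappa_2>0$: 1. all balls $\mathbb B(x,r)$, $r>0$, are compact; 2. $\mu^*(\mathbb B(x,r))=\mu^*(\{y:\rho(x,y)<r\})\le\kappa r^q$ for all $x\in\mathbb X$, $r>0$; 3. for all $x,y\in\mathbb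 X$ and $0<t\le1$ the series $\sum_k e^{-\lambda_k^2t}\phi_k(x)\phi_k(y)$ converges absolutely and $\left|\sum_k e^{-\lambda_k^2t}\phi_k(x)\phi_k(y)\right|\le\kappa_1t^{-q/2}\exp(-\kappa_2\rho(x,y)^2/t)$; 4. there are compact sets $\mathbb K_n\subset\mathbb X$ $(n=1,2,\dots)$ and $C_1,C_2>0$ with $\mathrm{diam}(\mathbb K_n)\le C_1n^{C_2}$, such that for every $S>0$ $$n^S\sup_{x\in\mathbb X\setminus\mathbb K_n}\sum_{\lambda_k<n}\phi_k(x)^2\to0,\qquad n^S\int_{\mathbb X\setminus\mathbb K_n}\Big(\sum_{\lambda_k<n}\phi_k^2\Big)^{1/2}d\mu^*\to0\qquad(n\to\infty).$$ Fix an even $C^\infty$ function $h:\mathbb R\to[0,1]$, non-increasing on $[0,\infty)$, with $h(t)=1$ for $|t|\le1/2$ and $h(t)=0$ for $t\ge1$, and put $$\Phi_n(x,y)=\sum_k h(\lambda_k/n)\phi_k(x)\phi_k(y),\qquad \sigma_n(\nu;f)(x)=\int_{\mathbb X}\Phi_n(x,y)f(y)\,d\nu(y).$$ For a probability measure $\nu^*$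 on $\mathbb X$ let $|\!|\!|\nu^*|\!|\!|_{R,0}$ be the infimum of all $c\ge 0$ with $\nu^*(\mathbb B(x,r))\le cr^q$ for all $x\in\mathbb X$, $r>0$. **Theorem 8.1.** For all $a,b>0$ there exist constants $c,c_1,c_3>0$, depending only on $\Xi$ (with $q$), $h$, $a$ and $b$, with the following property. Suppose that * (Bernstein–Lipschitz condition) $B_n>0$ and $|P(x)-P(y)|\le B_n\,\rho(x,y)\,\|P\|_\infty$ for all real $n>0$, $P\in\Pi_n$, $x,y\in\mathbb X$; * $f_0\in C_0(\mathbb X)$, $f_0\ge0$, $d\nu^*=f_0\,d\mu^*$ is a probability measure, and $|\!|\!|\nu^*|\!|\!|_{R,0}\ge a$; * $\Omega$ is a measurable space and $\tau$ is a probability measure on $\mathbb X\times\Omega$ whose marginal on $\mathbb X$ is $\nu^*$; * $\mathcal F:\mathbb X\times\Omega\to\mathbb R$ is measurable, $|\mathcal F(y,\epsilon)|\le1$ for all $y\in\mathbb X$, $\epsilon\in\Omega$, and $f:\mathbb X\to\mathbb R$ is measurable with $f(y)=\mathbb E_\tau(\mathcal F(y,\epsilon)\,|\,y)$ $\tau$-almost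 surely. Let $n\ge1$ be real with $B_n\ge b$, let $0<\delta<1$, let $M$ be an integer with $M\ge c_1n^q|\!|\!|\nu^*|\!|\!|_{R,0}\log(cnB_n/\delta)$, and let $(y_1,\epsilon_1),\dots,(y_M,\epsilon_M)$ be independent samples from $\tau$. Then $$\mathsf{Prob}\left(\left\|\frac1M\sum_{j=1}^M\mathcal F(y_j,\epsilon_j)\Phi_n(\circ,y_j)-\sigma_n(\nu^*;f)\right\|_\infty\ge c_3\sqrt{\frac{n^q|\!|\!|\nu^*|\!|\!|_{R,0}\log\left(cnB_n|\!|\!|\nu^*|\!|\!|_{R,0}/\delta\right)}{M}}\right)\le\frac{\delta}{|\!|\!|\nu^*|\!|\!|_{R,0}}.$$ -/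

import Mathlib

open MeasureTheory Filter Topology
open scoped ENNReal ZeroAtInfty ContDiff

noncomputable section

namespace DataSpace

variable {X : Type*} [MetricSpace X]

/-- The space `Π_n = span {φ_k : λ_k < n}` of diffusion polynomials of order `n`, inside the space
`C₀(X, ℝ)` of continuous functions vanishing at infinity (on a metric space with compact closed
balls these are automatically uniformly continuous). -/
def diffPoly (lam : ℕ → ℝ) (φ : ℕ → C₀(X, ℝ)) (n : ℝ) : Submodule ℝ C₀(X, ℝ) :=
  Submodule.span ℝ {P | ∃ k, lam k < n ∧ P = φ k}

/-- The finite sum `∑_{λ_k < n} φ_k(x)²` (finite because `λ_k → ∞`). -/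
def christoffel (lam : ℕ → ℝ) (φ : ℕ → C₀(X, ℝ)) (n : ℝ) (x : X) : ℝ :=
  ∑' k, if lam k < n then (φ k x) ^ 2 else 0

/-- A sequence in `[0, ∞]` is fast decreasing if `n ^ S * a n → 0` for every `S > 0`. -/
def FastDecreasing (a : ℕ → ℝ≥0∞) : Prop :=
  ∀ S : ℝ, 0 < S → Tendsto (fun n : ℕ => ENNReal.ofReal ((n : ℝ) ^ S) * a n) atTop (𝓝 0)

/-- `(X, ρ, μ, {λ_k}, {φ_k})` is a data space of exponent `q`, where `ρ` is the metric of `X`. -/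
structure IsDataSpace [MeasurableSpace X] (q : ℝ) (μ : Measure X) (lam : ℕ → ℝ)
    (φ : ℕ → C₀(X, ℝ)) : Prop where
  lam_zero : lam 0 = 0
  lam_mono : Monotone lam
  lam_tendsto : Tendsto lam atTop atTop
  integrable : ∀ k, Integrable (φ k) μ
  orthonormal : ∀ j k, ∫ x, φ j x * φ k x ∂μ = if j = k then 1 else 0
  phi_zero_pos : ∀ x, 0 < φ 0 x
  dense_diffPoly : Dense (⋃ n : ℝ, (diffPoly lam φ n : Set C₀(X, ℝ)))
  isCompact_closedBall : ∀ (x : X) (r : ℝ), 0 < r → IsCompact (Metric.closedBall x r)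
  one_le_q : 1 ≤ q
  /-- Ball measure condition. -/
  ball_measure : ∃ κ : ℝ, 0 < κ ∧ ∀ (x : X) (r : ℝ), 0 < r →
    μ (Metric.closedBall x r) = μ (Metric.ball x r) ∧
      μ (Metric.ball x r) ≤ ENNReal.ofReal (κ * r ^ q)
  /-- Gaussian upper bound; the convergence of the heat kernel series is part of the condition. -/
  gaussian_bound : ∃ κ₁ κ₂ : ℝ, 0 < κ₁ ∧ 0 < κ₂ ∧ ∀ (x y : X) (t : ℝ), 0 < t → t ≤ 1 →
    Summable (fun k => Real.exp (-(lam k) ^ 2 * t) * φ k x * φ k y) ∧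
      |∑' k, Real.exp (-(lam k) ^ 2 * t) * φ k x * φ k y| ≤
        κ₁ * t ^ (-q / 2) * Real.exp (-κ₂ * (dist x y ^ 2 / t))
  /-- Essential compactness. -/
  essential_compactness : ∃ K : ℕ → Set X,
    (∀ n, 1 ≤ n → IsCompact (K n)) ∧
    (∃ c₁ c₂ : ℝ, 0 < c₁ ∧ 0 < c₂ ∧ ∀ n : ℕ, 1 ≤ n → Metric.diam (K n) ≤ c₁ * (n : ℝ) ^ c₂) ∧
    FastDecreasing (fun n => ⨆ x ∈ (K n)ᶜ, ENNReal.ofReal (christoffel lam φ n x)) ∧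
    FastDecreasing (fun n =>
      ∫⁻ x in (K n)ᶜ, ENNReal.ofReal (Real.sqrt (christoffel lam φ n x)) ∂μ)

/-- The Bernstein-Lipschitz condition with the constants `B n`, `n > 0`; the norm on the right
is the `μ`-essential supremum. -/
def BernsteinLipschitz [MeasurableSpace X] (μ : Measure X) (lam : ℕ → ℝ) (φ : ℕ → C₀(X, ℝ))
    (B : ℝ → ℝ) : Prop :=
  ∀ n : ℝ, 0 < n → 0 < B n ∧ ∀ P ∈ diffPoly lam φ n, ∀ x y : X,
    |P x - P y| ≤ B n * dist x y * (eLpNorm P ∞ μ).toReal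

/-- The low pass filters `h : ℝ → [0, 1]` used to build the localized kernels. -/
structure IsLowPass (h : ℝ → ℝ) : Prop where
  mem_Icc : ∀ t, h t ∈ Set.Icc (0 : ℝ) 1
  smooth : ContDiff ℝ ∞ h
  even : ∀ t, h (-t) = h t
  antitone : AntitoneOn h (Set.Ici 0)
  eq_one : ∀ t, |t| ≤ 1 / 2 → h t = 1
  eq_zero : ∀ t, 1 ≤ t → h t = 0

/-- The kernel `Φ_n(x, y) = ∑_k h(λ_k / n) φ_k(x) φ_k(y)` (a finite sum for a low pass `h`). -/
def kern (lam : ℕ → ℝ) (φ : ℕ → C₀(X, ℝ)) (h : ℝ → ℝ) (n : ℝ) (x y : X) : ℝ :=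
  ∑' k, h (lam k / n) * φ k x * φ k y

/-- The operator `σ_n(ν; f)(x) = ∫ Φ_n(x, y) f(y) dν(y)`. -/
def sigmaOp [MeasurableSpace X] (lam : ℕ → ℝ) (φ : ℕ → C₀(X, ℝ)) (h : ℝ → ℝ) (n : ℝ)
    (ν : Measure X) (f : X → ℝ) (x : X) : ℝ :=
  ∫ y, kern lam φ h n x y * f y ∂ν

/-- For a positive measure `ν`, the infimum of all constants `c` with
`ν(𝔹(x, r)) ≤ c (r + d) ^ q` for all `x` and all `r > 0`, where `𝔹(x, r)` is the closed ball. -/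
def regularNorm [MeasurableSpace X] (q d : ℝ) (ν : Measure X) : ℝ :=
  sInf {c : ℝ | 0 ≤ c ∧ ∀ (x : X) (r : ℝ), 0 < r →
    ν (Metric.closedBall x r) ≤ ENNReal.ofReal (c * (r + d) ^ q)}

/-- The measure `ν* = f₀ dμ`. -/
def densityMeasure [MeasurableSpace X] (μ : Measure X) (f₀ : C₀(X, ℝ)) : Measure X :=
  μ.withDensity (fun x => ENNReal.ofReal (f₀ x))

/-- The empirical sum `(1/M) ∑_j F(y_j, ε_j) Φ_n(x, y_j)` of a sample `z_j = (y_j, ε_j)`. -/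
def empirical {Ω : Type*} (lam : ℕ → ℝ) (φ : ℕ → C₀(X, ℝ)) (h : ℝ → ℝ) (n : ℝ)
    (F : X × Ω → ℝ) {M : ℕ} (z : Fin M → X × Ω) (x : X) : ℝ :=
  (1 / (M : ℝ)) * ∑ j, F (z j) * kern lam φ h n x (z j).1

end DataSpace

end

/-! For fixed x the empirical sum is a mean of independent bounded variables with expectation
`sigmaOp` at x, so a Bernstein inequality applies. Two points carry the theorem: a variance bound of
order n^q R, where R is the regularity norm of ν*, and the passage from fixed x to the supremum over
x.

Variance. It suffices that Φ_n is localized near the diagonal (`exists_kern_localized`). With u =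
exp(-(λ_k/n)²) and χ(u) = h(√(-log u))/u, one has h(λ_k/n) = χ(u)u, and χ is smooth. Replacing χ by
a polynomial p of degree J turns the kernel into a combination of heat kernels at times (i+1)/n², i
≤ J. The Gaussian bound controls this combination, and the heat kernel on the diagonal controls the
approximation error. Taking J proportional to n times the distance gives decay of any polynomial
order. Integration over dyadic balls bounds ∫Φ_n(x,y)² dν*(y) (`exists_lintegral_kern_sq_le`) and
the L¹(μ) norms of Φ_n(x,·) (`exists_lintegral_abs_kern_le`).

Uniformity. The deviation P lies in Π_n and is reproduced by Φ_{2n}, whose L¹ norms are bounded.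
Hence if |P| < t off a set of μ-measure at most a small multiple of n^{-q}, then |P| ≤ 2Lt
everywhere (`exists_sup_le_of_measure_le`). By Tonelli the expected measure of {|P| ≥ t} is the
μ-integral of the pointwise tails, and Markov's inequality concludes (`exists_uniform_tail`). As μ
may be infinite, the tails must be integrable in x: where the Christoffel function is small so is
the variance, and `exists_pointwise_tail` keeps this as a weight whose integral is polynomial in n
by essential compactness. The logarithm in the deviation absorbs that power of n. -/

noncomputable section

namespace DataSpace

/-! ### Polynomial approximation of smooth functions with controlled coefficients -/

/-- The recursion T_{m+2} = 2X T_{m+1} - T_m and 2·3 + 1 ≤ 9 give the bound; the recursion has two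
terms, so the induction carries m and m+1 together. Geometric growth is affordable because a
Gaussian factor beats it later. -/
theorem sum_abs_coeff_chebyshev_le (m : ℕ) :
    (∀ N, ∑ i ∈ Finset.range N, |(Polynomial.Chebyshev.T ℝ (m : ℤ)).coeff i| ≤ 3 ^ m) ∧
    ∀ N, ∑ i ∈ Finset.range N, |(Polynomial.Chebyshev.T ℝ ((m + 1 : ℕ) : ℤ)).coeff i|
      ≤ 3 ^ (m + 1) := by
  induction m with
  | zero =>
    constructor
    · intro N
      simp only [Nat.cast_zero, Polynomial.Chebyshev.T_zero, Polynomial.coeff_one, apply_ite abs,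
        abs_one, abs_zero, Finset.sum_ite_eq', pow_zero]
      split_ifs <;> norm_num
    · intro N
      simp only [zero_add, Nat.cast_one, Polynomial.Chebyshev.T_one, Polynomial.coeff_X,
        apply_ite abs, abs_one, abs_zero, Finset.sum_ite_eq, pow_one]
      split_ifs <;> norm_num
  | succ m ih =>
    refine ⟨ih.2, fun N => ?_⟩
    have h1 : Polynomial.Chebyshev.T ℝ ((m + 1 + 1 : ℕ) : ℤ) =
        2 * Polynomial.X * Polynomial.Chebyshev.T ℝ ((m + 1 : ℕ) : ℤ)
          - Polynomial.Chebyshev.T ℝ (m : ℤ) := by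
      have := Polynomial.Chebyshev.T_add_two ℝ (m : ℤ)
      push_cast at this ⊢
      rw [← this]; congr 1
    have h3 : ∑ i ∈ Finset.range N,
        |(2 * Polynomial.X * Polynomial.Chebyshev.T ℝ ((m + 1 : ℕ) : ℤ)).coeff i|
          ≤ 2 * 3 ^ (m + 1) := by
      cases N with
      | zero => simp
      | succ N =>
        rw [Finset.sum_range_succ']
        simp only [mul_assoc, ← Polynomial.C_ofNat, Polynomial.coeff_C_mul, abs_mul,
          Polynomial.coeff_X_mul, Polynomial.mul_coeff_zero, Polynomial.coeff_X_zero, zero_mul,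
          abs_zero, mul_zero, add_zero, ← Finset.mul_sum, abs_two]
        have := ih.2 N
        linarith
    rw [h1]
    calc _ ≤ ∑ i ∈ Finset.range N,
          (|(2 * Polynomial.X * Polynomial.Chebyshev.T ℝ ((m + 1 : ℕ) : ℤ)).coeff i|
            + |(Polynomial.Chebyshev.T ℝ (m : ℤ)).coeff i|) := by
          gcongr with i hi
          rw [Polynomial.coeff_sub]; exact abs_sub _ _
      _ ≤ 2 * 3 ^ (m + 1) + 3 ^ m := by
          rw [Finset.sum_add_distrib]
          exact add_le_add h3 (ih.1 N)
      _ ≤ _ := by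
          rw [pow_succ, pow_succ, pow_succ]
          nlinarith [pow_pos (by norm_num : (0 : ℝ) < 3) m]

/-- The Fourier coefficient of a `2π`-periodic function. -/
def fourCoeff (g : ℝ → ℂ) (m : ℤ) : ℂ :=
  fourierCoeffOn Real.two_pi_pos g m

theorem fourCoeff_eq (g : ℝ → ℂ) (m : ℤ) : fourCoeff g m =
    (1 / (2 * Real.pi) : ℝ) • ∫ x in (0 : ℝ)..(2 * Real.pi),
      Complex.exp (-(Complex.I * m * x)) * g x := by
  rw [fourCoeff, fourierCoeffOn_eq_integral]
  simp only [sub_zero, fourier_coe_apply, smul_eq_mul]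
  congr 1
  apply intervalIntegral.integral_congr
  intro x _
  simp only
  congr 2
  push_cast
  have : (Real.pi : ℂ) ≠ 0 := by exact_mod_cast Real.pi_ne_zero
  field_simp

theorem norm_fourCoeff_le {g : ℝ → ℂ} {C : ℝ} (hC : ∀ x, ‖g x‖ ≤ C) (m : ℤ) :
    ‖fourCoeff g m‖ ≤ C := by
  rw [fourCoeff_eq, norm_smul]
  have h1 : ‖∫ x in (0 : ℝ)..(2 * Real.pi), Complex.exp (-(Complex.I * m * x)) * g x‖
      ≤ C * |2 * Real.pi - 0| := by
    apply intervalIntegral.norm_integral_le_of_norm_le_const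
    intro x _
    rw [norm_mul, Complex.norm_exp]
    simpa using hC x
  have hp := Real.two_pi_pos
  rw [sub_zero, abs_of_pos hp] at h1
  rw [Real.norm_of_nonneg (by positivity)]
  calc _ ≤ 1 / (2 * Real.pi) * (C * (2 * Real.pi)) := by gcongr
    _ = C := by field_simp

theorem fourCoeff_deriv {g : ℝ → ℂ} (hg : ContDiff ℝ ∞ g) (hper : g.Periodic (2 * Real.pi))
    {m : ℤ} (hm : m ≠ 0) : ‖fourCoeff (deriv g) m‖ = |(m : ℝ)| * ‖fourCoeff g m‖ := by
  have hd : Differentiable ℝ g := hg.differentiable (by simp)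
  have hc : Continuous (deriv g) := hg.continuous_deriv (by simp)
  have h := fourierCoeffOn_of_hasDerivAt Real.two_pi_pos hm
    (fun x _ => (hd x).hasDerivAt) (hc.intervalIntegrable _ _)
  have h0 : g (2 * Real.pi) = g 0 := by simpa using hper 0
  rw [h0, sub_self, mul_zero, zero_sub] at h
  have hp : (Real.pi : ℂ) ≠ 0 := by exact_mod_cast Real.pi_ne_zero
  have hmc : (m : ℂ) ≠ 0 := by exact_mod_cast hm
  have h2 : fourCoeff (deriv g) m = Complex.I * m * fourCoeff g m := by
    unfold fourCoeff
    rw [h]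
    push_cast
    field_simp
    simp [mul_assoc]
  rw [h2]
  simp [Complex.norm_intCast]

/-- Periodicity kills the boundary term in each integration by parts, so every derivative gains a
factor |m|. -/
theorem exists_fourCoeff_decay (k : ℕ) : ∀ {g : ℝ → ℂ}, ContDiff ℝ ∞ g →
    g.Periodic (2 * Real.pi) →
    ∃ C : ℝ, 0 ≤ C ∧ ∀ m : ℤ, |(m : ℝ)| ^ k * ‖fourCoeff g m‖ ≤ C := by
  induction k with
  | zero =>
    intro g hg hper
    obtain ⟨C, hC⟩ := (isCompact_Icc (a := (0 : ℝ)) (b := 2 * Real.pi)).exists_bound_of_continuousOn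
      hg.continuous.continuousOn
    have hC' : ∀ x, ‖g x‖ ≤ C := by
      intro x
      obtain ⟨y, hy, hxy⟩ := hper.exists_mem_Ico₀ Real.two_pi_pos x
      rw [hxy]
      exact hC y ⟨hy.1, hy.2.le⟩
    exact ⟨C, (norm_nonneg _).trans (hC' 0), fun m => by simpa using norm_fourCoeff_le hC' m⟩
  | succ k ih =>
    intro g hg hper
    have hg' : ContDiff ℝ ∞ (deriv g) := (contDiff_infty_iff_deriv.1 hg).2
    have hper' : (deriv g).Periodic (2 * Real.pi) := by
      intro x
      rw [← deriv_comp_add_const]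
      congr 1
      funext y
      exact hper y
    obtain ⟨C, hC0, hC⟩ := ih hg' hper'
    refine ⟨C, hC0, fun m => ?_⟩
    by_cases hm : m = 0
    · simpa [hm] using hC0
    · have := hC m
      rw [fourCoeff_deriv hg hper hm] at this
      rw [pow_succ, mul_assoc]
      exact this

theorem hasSum_fourCoeff {g : ℝ → ℂ} (hg : Continuous g) (hper : g.Periodic (2 * Real.pi))
    (hs : Summable (fourCoeff g)) (x : ℝ) :
    HasSum (fun m : ℤ => fourCoeff g m * Complex.exp (Complex.I * m * x)) (g x) := by
  have : Fact (0 < 2 * Real.pi) := ⟨Real.two_pi_pos⟩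
  let f : C(AddCircle (2 * Real.pi), ℂ) := ⟨hper.lift, hg.quotient_lift _⟩
  have hf : ∀ m, fourierCoeff f m = fourCoeff g m := by
    intro m
    rw [fourCoeff_eq, fourierCoeff_eq_intervalIntegral f m 0, zero_add]
    congr 1
    apply intervalIntegral.integral_congr
    intro x _
    have : f (x : AddCircle (2 * Real.pi)) = g x := rfl
    simp only [this, fourier_coe_apply, smul_eq_mul]
    congr 2
    push_cast
    have : (Real.pi : ℂ) ≠ 0 := by exact_mod_cast Real.pi_ne_zero
    field_simp
  have hs' : Summable (fourierCoeff f) := by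
    convert hs using 1; funext m; exact hf m
  have h := has_pointwise_sum_fourier_series_of_summable hs' (x : AddCircle (2 * Real.pi))
  have hfx : f (x : AddCircle (2 * Real.pi)) = g x := rfl
  rw [hfx] at h
  convert h using 2 with m
  rw [hf, fourier_coe_apply, smul_eq_mul]
  congr 2
  push_cast
  have : (Real.pi : ℂ) ≠ 0 := by exact_mod_cast Real.pi_ne_zero
  field_simp

/-- The real Fourier coefficients of a smooth function of `cos θ` decay fast. -/
theorem exists_cos_expansion {χ : ℝ → ℝ} (hχ : ContDiff ℝ ∞ χ) (S : ℕ) :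
    ∃ (C : ℝ) (r : ℤ → ℝ), 0 ≤ C ∧ (∀ m : ℤ, |(m : ℝ)| ^ S * |r m| ≤ C) ∧
      Summable (fun m => |r m|) ∧
      ∀ θ : ℝ, HasSum (fun m : ℤ => r m * Real.cos (m * θ)) (χ (Real.cos θ)) := by
  set g : ℝ → ℂ := fun θ => ((χ (Real.cos θ) : ℝ) : ℂ) with hgdef
  have hg : ContDiff ℝ ∞ g := Complex.ofRealCLM.contDiff.comp (hχ.comp Real.contDiff_cos)
  have hper : g.Periodic (2 * Real.pi) := fun x => by simp [hgdef]
  obtain ⟨C, hC0, hC⟩ := exists_fourCoeff_decay S hg hper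
  obtain ⟨C2, -, hC2⟩ := exists_fourCoeff_decay 2 hg hper
  have hsn : Summable (fun m => ‖fourCoeff g m‖) := by
    have h1 : Summable (fun m : ℤ => C2 * (1 / (m : ℝ) ^ 2)) :=
      ((Real.summable_one_div_int_pow (p := 2)).2 one_lt_two).mul_left _
    refine Summable.of_norm_bounded_eventually h1 ?_
    have : ∀ᶠ m : ℤ in cofinite, m ≠ 0 := by
      rw [Filter.eventually_cofinite]
      exact (Set.finite_singleton (0 : ℤ)).subset (fun m hm => by simpa using hm)
    filter_upwards [this] with m hm
    have hm' : (0 : ℝ) < (m : ℝ) ^ 2 := by positivity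
    have := hC2 m
    rw [sq_abs] at this
    rw [norm_norm, mul_one_div, le_div_iff₀ hm']
    linarith
  have hs : Summable (fourCoeff g) := hsn.of_norm
  refine ⟨C, fun m => (fourCoeff g m).re, hC0, ?_, ?_, ?_⟩
  · intro m
    exact (mul_le_mul_of_nonneg_left (Complex.abs_re_le_norm _) (by positivity)).trans (hC m)
  · exact Summable.of_nonneg_of_le (fun _ => abs_nonneg _) (fun m => Complex.abs_re_le_norm _) hsn
  · intro θ
    have h1 := hasSum_fourCoeff hg.continuous hper hs θ
    have h2 := hasSum_fourCoeff hg.continuous hper hs (-θ)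
    have hgn : g (-θ) = g θ := by simp [hgdef]
    rw [hgn] at h2
    -- Since g is even, averaging the expansions at θ and -θ turns exponentials into cosines.
    have h3 := (h1.add h2).mul_left (1 / 2 : ℂ)
    have h4 := Complex.hasSum_re h3
    convert h4 using 2 with m
    · have : (1 / 2 : ℂ) * (fourCoeff g m * Complex.exp (Complex.I * m * θ)
          + fourCoeff g m * Complex.exp (Complex.I * m * ((-θ : ℝ) : ℂ)))
          = fourCoeff g m * ((Real.cos (m * θ) : ℝ) : ℂ) := by
        rw [Complex.ofReal_cos, Complex.cos]
        push_cast
        rw [show Complex.I * m * θ = m * θ * Complex.I by ring,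
          show Complex.I * m * (-θ : ℂ) = -(m * θ) * Complex.I by ring]
        ring
      rw [this, Complex.re_mul_ofReal]
    · have : (1 / 2 : ℂ) * (g θ + g θ) = ((χ (Real.cos θ) : ℝ) : ℂ) := by
        rw [hgdef]; ring
      rw [this, Complex.ofReal_re]

/-- With u = cos θ, the truncated cosine series is a Chebyshev sum. Fast error decay and at most
geometric coefficient growth are needed for the same polynomial. -/
theorem exists_polynomial_approx {χ : ℝ → ℝ} (hχ : ContDiff ℝ ∞ χ) (S : ℕ) :
    ∃ C : ℝ, 0 ≤ C ∧ ∀ J : ℕ, ∃ p : Polynomial ℝ, p.natDegree ≤ J ∧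
      ∑ i ∈ Finset.range (J + 1), |p.coeff i| ≤ C * 3 ^ J ∧
      ∀ u ∈ Set.Icc (-1 : ℝ) 1, |χ u - p.eval u| ≤ C / ((J : ℝ) + 1) ^ S := by
  -- Two extra powers of m leave the convergent series of 1/m² once (J+1)^{-S} is taken out of the
  -- tail. Its term at m = 0 is 0 by convention, harmlessly since 0 ∈ `s`.
  obtain ⟨C, r, hC0, hdec, hsum, hexp⟩ := exists_cos_expansion hχ (S + 2)
  have hsq : Summable (fun m : ℤ => 1 / (m : ℝ) ^ 2) :=
    (Real.summable_one_div_int_pow (p := 2)).2 one_lt_two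
  set A := ∑' m : ℤ, 1 / (m : ℝ) ^ 2 with hA
  have hA0 : 0 ≤ A := tsum_nonneg fun m => by positivity
  set D := ∑' m : ℤ, |r m| with hD
  have hD0 : 0 ≤ D := tsum_nonneg fun m => abs_nonneg _
  refine ⟨D + C * A, by positivity, fun J => ?_⟩
  set s : Finset ℤ := Finset.Icc (-(J : ℤ)) J with hs
  refine ⟨∑ m ∈ s, Polynomial.C (r m) * Polynomial.Chebyshev.T ℝ m, ?_, ?_, ?_⟩
  · refine Polynomial.natDegree_sum_le_of_forall_le _ _ fun m hm => ?_
    refine (Polynomial.natDegree_C_mul_le _ _).trans ?_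
    rw [Polynomial.Chebyshev.natDegree_T]
    have := Finset.mem_Icc.1 hm
    omega
  · calc _ ≤ ∑ i ∈ Finset.range (J + 1), ∑ m ∈ s,
          |r m| * |(Polynomial.Chebyshev.T ℝ m).coeff i| := by
          refine Finset.sum_le_sum fun i _ => ?_
          rw [Polynomial.finsetSum_coeff]
          refine (Finset.abs_sum_le_sum_abs _ _).trans (le_of_eq ?_)
          refine Finset.sum_congr rfl fun m _ => ?_
          rw [Polynomial.coeff_C_mul, abs_mul]
      _ = ∑ m ∈ s, |r m| * ∑ i ∈ Finset.range (J + 1),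
            |(Polynomial.Chebyshev.T ℝ m).coeff i| := by
          rw [Finset.sum_comm]
          simp_rw [Finset.mul_sum]
      _ ≤ ∑ m ∈ s, |r m| * 3 ^ J := by
          refine Finset.sum_le_sum fun m hm => ?_
          gcongr
          rw [← Polynomial.Chebyshev.T_natAbs]
          refine ((sum_abs_coeff_chebyshev_le m.natAbs).1 _).trans ?_
          have := Finset.mem_Icc.1 hm
          exact pow_le_pow_right₀ (by norm_num) (by omega)
      _ ≤ (D + C * A) * 3 ^ J := by
          rw [← Finset.sum_mul]
          gcongr
          have := hsum.sum_le_tsum s (fun m _ => abs_nonneg _)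
          have h2 : 0 ≤ C * A := by positivity
          linarith
  · intro u hu
    have hcos : Real.cos (Real.arccos u) = u := Real.cos_arccos hu.1 hu.2
    set θ := Real.arccos u
    have h1 := hexp θ
    rw [hcos] at h1
    have hev : (∑ m ∈ s, Polynomial.C (r m) * Polynomial.Chebyshev.T ℝ m).eval u =
        ∑ m ∈ s, r m * Real.cos (m * θ) := by
      rw [Polynomial.eval_finsetSum]
      refine Finset.sum_congr rfl fun m _ => ?_
      rw [Polynomial.eval_mul, Polynomial.eval_C, ← hcos, Polynomial.Chebyshev.T_real_cos]
    have h2 : HasSum (fun m : ℤ => if m ∈ s then r m * Real.cos (m * θ) else 0)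
        (∑ m ∈ s, r m * Real.cos (m * θ)) := by
      have : HasSum (fun m : ℤ => if m ∈ s then r m * Real.cos (m * θ) else 0)
          (∑ m ∈ s, if m ∈ s then r m * Real.cos (m * θ) else 0) :=
        hasSum_sum_of_ne_finset_zero (fun m hm => by simp [hm])
      rwa [Finset.sum_congr rfl (fun m hm => if_pos hm)] at this
    have h3 := h1.sub h2
    rw [hev, ← h3.tsum_eq, ← Real.norm_eq_abs]
    have hJ : (0 : ℝ) < ((J : ℝ) + 1) ^ S := by positivity
    have h4 : HasSum (fun m : ℤ => C / ((J : ℝ) + 1) ^ S * (1 / (m : ℝ) ^ 2))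
        (C / ((J : ℝ) + 1) ^ S * A) := hsq.hasSum.mul_left _
    refine (tsum_of_norm_bounded h4 fun m => ?_).trans ?_
    · by_cases hm : m ∈ s
      · simp only [hm, if_true, sub_self, norm_zero]
        positivity
      · simp only [hm, if_false, sub_zero, Real.norm_eq_abs]
        have hmJ : (J : ℝ) + 1 ≤ |(m : ℝ)| := by
          have : (J : ℤ) + 1 ≤ |m| := by
            by_contra hcon
            apply hm
            rw [hs, Finset.mem_Icc, ← abs_le]
            omega
          exact_mod_cast this
        have hm0 : (0 : ℝ) < |(m : ℝ)| := by linarith [(Nat.cast_nonneg J : (0 : ℝ) ≤ J)]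
        have hd := hdec m
        rw [abs_mul, div_mul_div_comm, mul_one, le_div_iff₀ (by
          rw [← sq_abs]; positivity), ← sq_abs]
        calc |r m| * |Real.cos (m * θ)| * (((J : ℝ) + 1) ^ S * |(m : ℝ)| ^ 2)
            ≤ |r m| * 1 * (|(m : ℝ)| ^ S * |(m : ℝ)| ^ 2) := by
              gcongr
              exact Real.abs_cos_le_one _
          _ = |(m : ℝ)| ^ (S + 2) * |r m| := by ring
          _ ≤ C := hd
    · rw [div_mul_eq_mul_div]
      gcongr
      linarith

/-! ### Elementary facts on data spaces -/

theorem finite_setOf_lt {lam : ℕ → ℝ} (hl : Tendsto lam atTop atTop) (n : ℝ) :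
    {k | lam k < n}.Finite := by
  have h := hl.eventually_ge_atTop n
  rw [← Nat.cofinite_eq_atTop, Filter.eventually_cofinite] at h
  simpa using h

/-- The finite set of indices `k` with `λ_k < n`. -/
def lowIndices {lam : ℕ → ℝ} (hl : Tendsto lam atTop atTop) (n : ℝ) : Finset ℕ :=
  (finite_setOf_lt hl n).toFinset

theorem mem_lowIndices {lam : ℕ → ℝ} (hl : Tendsto lam atTop atTop) {n : ℝ} {k : ℕ} :
    k ∈ lowIndices hl n ↔ lam k < n := by
  simp [lowIndices]

theorem lowIndices_mono {lam : ℕ → ℝ} (hl : Tendsto lam atTop atTop) {n m : ℝ} (hnm : n ≤ m) :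
    lowIndices hl n ⊆ lowIndices hl m := by
  intro k hk
  rw [mem_lowIndices] at hk ⊢
  linarith

section

variable {X : Type*} [MetricSpace X] {lam : ℕ → ℝ} {φ : ℕ → C₀(X, ℝ)}

theorem christoffel_eq_sum (hl : Tendsto lam atTop atTop) (n : ℝ) (x : X) :
    christoffel lam φ n x = ∑ k ∈ lowIndices hl n, (φ k x) ^ 2 := by
  rw [christoffel, tsum_eq_sum (s := lowIndices hl n)]
  · refine Finset.sum_congr rfl fun k hk => ?_
    rw [if_pos ((mem_lowIndices hl).1 hk)]
  · intro k hk
    rw [mem_lowIndices] at hk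
    rw [if_neg hk]

theorem christoffel_mono (hl : Tendsto lam atTop atTop) {n m : ℝ} (hnm : n ≤ m) (x : X) :
    christoffel lam φ n x ≤ christoffel lam φ m x := by
  rw [christoffel_eq_sum hl, christoffel_eq_sum hl]
  exact Finset.sum_le_sum_of_subset_of_nonneg (lowIndices_mono hl hnm)
    fun _ _ _ => sq_nonneg _

theorem kern_eq_sum (hl : Tendsto lam atTop atTop) {h : ℝ → ℝ} (hh : IsLowPass h) {n : ℝ}
    (hn : 0 < n) (x y : X) :
    kern lam φ h n x y = ∑ k ∈ lowIndices hl n, h (lam k / n) * φ k x * φ k y := by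
  rw [kern, tsum_eq_sum]
  intro k hk
  rw [mem_lowIndices, not_lt] at hk
  rw [hh.eq_zero _ ((one_le_div hn).2 hk)]
  simp

theorem abs_kern_le (hl : Tendsto lam atTop atTop) {h : ℝ → ℝ} (hh : IsLowPass h) {n : ℝ}
    (hn : 0 < n) (x y : X) :
    |kern lam φ h n x y| ≤ √(christoffel lam φ n x) * √(christoffel lam φ n y) := by
  rw [kern_eq_sum hl hh hn, christoffel_eq_sum hl, christoffel_eq_sum hl]
  refine (Finset.abs_sum_le_sum_abs _ _).trans ?_
  have := Real.sum_mul_le_sqrt_mul_sqrt (lowIndices hl n) (fun k => |φ k x|) (fun k => |φ k y|)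
  simp only [sq_abs] at this
  refine le_trans (Finset.sum_le_sum fun k _ => ?_) this
  rw [abs_mul, abs_mul, mul_assoc]
  have h1 := hh.mem_Icc (lam k / n)
  rw [abs_of_nonneg h1.1]
  exact mul_le_of_le_one_left (by positivity) h1.2

theorem continuous_kern_right (hl : Tendsto lam atTop atTop) {h : ℝ → ℝ} (hh : IsLowPass h) {n : ℝ}
    (hn : 0 < n) (x : X) : Continuous (kern lam φ h n x) := by
  have : kern lam φ h n x = fun y => ∑ k ∈ lowIndices hl n, h (lam k / n) * φ k x * φ k y :=
    funext fun y => kern_eq_sum hl hh hn x y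
  rw [this]
  exact continuous_finsetSum _ fun k _ => continuous_const.mul (φ k).continuous

end

namespace IsDataSpace

variable {X : Type*} [MetricSpace X] [MeasurableSpace X] {q : ℝ} {μ : Measure X} {lam : ℕ → ℝ}
  {φ : ℕ → C₀(X, ℝ)}

theorem lam_nonneg (hX : IsDataSpace q μ lam φ) (k : ℕ) : 0 ≤ lam k := by
  rw [← hX.lam_zero]; exact hX.lam_mono (Nat.zero_le k)

/-- The heat kernel at time `j / n²`, bounded off the diagonal. -/
theorem exists_heat_bound (hX : IsDataSpace q μ lam φ) :
    ∃ κ₁ κ₂ : ℝ, 0 < κ₁ ∧ 0 < κ₂ ∧ ∀ (n : ℝ) (j : ℕ), 1 ≤ n → 1 ≤ j → (j : ℝ) ≤ n ^ 2 →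
      ∀ x y : X,
      Summable (fun k => Real.exp (-(lam k / n) ^ 2) ^ j * (φ k x * φ k y)) ∧
      |∑' k, Real.exp (-(lam k / n) ^ 2) ^ j * (φ k x * φ k y)| ≤
        κ₁ * n ^ q * Real.exp (-κ₂ * (dist x y ^ 2 * n ^ 2 / j)) := by
  obtain ⟨κ₁, κ₂, h1, h2, H⟩ := hX.gaussian_bound
  refine ⟨κ₁, κ₂, h1, h2, fun n j hn hj hjn x y => ?_⟩
  have hn0 : 0 < n := by linarith
  have hj1 : (1 : ℝ) ≤ j := by exact_mod_cast hj
  have hq := hX.one_le_q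
  obtain ⟨hs, hb⟩ := H x y (j / n ^ 2) (by positivity) ((div_le_one (by positivity)).2 hjn)
  have e : (fun k => Real.exp (-(lam k / n) ^ 2) ^ j * (φ k x * φ k y)) =
      fun k => Real.exp (-(lam k) ^ 2 * (j / n ^ 2)) * φ k x * φ k y := by
    funext k
    rw [← Real.exp_nat_mul, mul_assoc (Real.exp _)]
    congr 2
    field_simp
  rw [e]
  refine ⟨hs, hb.trans ?_⟩
  have e2 : dist x y ^ 2 / ((j : ℝ) / n ^ 2) = dist x y ^ 2 * n ^ 2 / j := by
    field_simp
  rw [e2]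
  gcongr
  calc ((j : ℝ) / n ^ 2) ^ (-q / 2) ≤ (1 / n ^ 2) ^ (-q / 2) := by
        apply Real.rpow_le_rpow_of_nonpos (by positivity) (by gcongr) (by linarith)
    _ = n ^ q := by
        rw [one_div, Real.inv_rpow (by positivity), ← Real.rpow_neg (by positivity),
          ← Real.rpow_natCast, ← Real.rpow_mul hn0.le]
        congr 1
        push_cast
        ring

/-- On the diagonal all heat kernel terms are nonnegative, and at time n^{-2} those with λ_k < n
carry weight at least e^{-1}. -/
theorem exists_christoffel_le (hX : IsDataSpace q μ lam φ) :
    ∃ C : ℝ, 0 < C ∧ ∀ (n : ℝ), 1 ≤ n → ∀ x : X, christoffel lam φ n x ≤ C * n ^ q := by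
  obtain ⟨κ₁, κ₂, h1, h2, H⟩ := hX.exists_heat_bound
  refine ⟨Real.exp 1 * κ₁, by positivity, fun n hn x => ?_⟩
  have hn0 : 0 < n := by linarith
  obtain ⟨hs, hb⟩ := H n 1 hn le_rfl (by push_cast; nlinarith) x x
  simp only [pow_one, dist_self, ne_eq, OfNat.ofNat_ne_zero, not_false_eq_true, zero_pow, zero_mul,
    zero_div, mul_zero, Real.exp_zero, mul_one] at hs hb
  have h3 : Real.exp (-1) * christoffel lam φ n x ≤ κ₁ * n ^ q := by
    rw [christoffel_eq_sum hX.lam_tendsto, Finset.mul_sum]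
    refine le_trans ?_ ((le_abs_self _).trans hb)
    refine le_trans (Finset.sum_le_sum fun k hk => ?_)
      (hs.sum_le_tsum (lowIndices hX.lam_tendsto n)
        (fun k _ => mul_nonneg (Real.exp_nonneg _) (mul_self_nonneg _)))
    rw [mem_lowIndices] at hk
    have h4 : lam k / n ≤ 1 := (div_le_one hn0).2 hk.le
    have h5 : 0 ≤ lam k / n := div_nonneg (hX.lam_nonneg k) hn0.le
    rw [pow_two (φ k x)]
    refine mul_le_mul_of_nonneg_right (Real.exp_le_exp.2 (neg_le_neg ?_)) (mul_self_nonneg _)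
    nlinarith
  rw [Real.exp_neg, inv_mul_le_iff₀ (Real.exp_pos _)] at h3
  linarith

theorem christoffel_pos (hX : IsDataSpace q μ lam φ) {n : ℝ} (hn : 0 < n) (x : X) :
    0 < christoffel lam φ n x := by
  rw [christoffel_eq_sum hX.lam_tendsto]
  have h0 : 0 ∈ lowIndices hX.lam_tendsto n := by
    rw [mem_lowIndices, hX.lam_zero]; exact hn
  exact Finset.sum_pos' (fun k _ => sq_nonneg _) ⟨0, h0, pow_pos (hX.phi_zero_pos x) 2⟩

/-- The kernel of `p(T) T`, for a polynomial `p` and the heat operator `T` at time `1 / n²`. -/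
theorem exists_polynomial_kernel_bound (hX : IsDataSpace q μ lam φ) :
    ∃ κ₁ κ₂ : ℝ, 0 < κ₁ ∧ 0 < κ₂ ∧ ∀ (n : ℝ) (J : ℕ) (p : Polynomial ℝ) (x y : X), 1 ≤ n →
      (J : ℝ) + 1 ≤ n ^ 2 → p.natDegree ≤ J →
      Summable (fun k => p.eval (Real.exp (-(lam k / n) ^ 2)) * Real.exp (-(lam k / n) ^ 2) *
        (φ k x * φ k y)) ∧
      |∑' k, p.eval (Real.exp (-(lam k / n) ^ 2)) * Real.exp (-(lam k / n) ^ 2) *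
        (φ k x * φ k y)| ≤ (∑ i ∈ Finset.range (J + 1), |p.coeff i|) *
          (κ₁ * n ^ q * Real.exp (-κ₂ * (dist x y ^ 2 * n ^ 2 / (J + 1)))) := by
  obtain ⟨κ₁, κ₂, h1, h2, H⟩ := hX.exists_heat_bound
  refine ⟨κ₁, κ₂, h1, h2, fun n J p x y hn hJ hp => ?_⟩
  have hn0 : 0 < n := by linarith
  have e : (fun k => p.eval (Real.exp (-(lam k / n) ^ 2)) * Real.exp (-(lam k / n) ^ 2) *
        (φ k x * φ k y)) = fun k => ∑ i ∈ Finset.range (J + 1), p.coeff i *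
          (Real.exp (-(lam k / n) ^ 2) ^ (i + 1) * (φ k x * φ k y)) := by
    funext k
    rw [Polynomial.eval_eq_sum_range' (Nat.lt_succ_of_le hp), Finset.sum_mul, Finset.sum_mul]
    refine Finset.sum_congr rfl fun i _ => ?_
    ring
  have hi : ∀ i ∈ Finset.range (J + 1), ((i + 1 : ℕ) : ℝ) ≤ J + 1 := by
    intro i hi
    have := Finset.mem_range.1 hi
    exact_mod_cast this
  have hsum : ∀ i ∈ Finset.range (J + 1), Summable fun k => p.coeff i *
          (Real.exp (-(lam k / n) ^ 2) ^ (i + 1) * (φ k x * φ k y)) := fun i hi' =>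
    (H n (i + 1) hn (by omega) ((hi i hi').trans hJ) x y).1.mul_left _
  rw [e]
  refine ⟨summable_sum hsum, ?_⟩
  rw [Summable.tsum_finsetSum hsum, Finset.sum_mul]
  refine (Finset.abs_sum_le_sum_abs _ _).trans (Finset.sum_le_sum fun i hi' => ?_)
  rw [tsum_mul_left, abs_mul]
  gcongr
  refine (H n (i + 1) hn (by omega) ((hi i hi').trans hJ) x y).2.trans ?_
  refine mul_le_mul_of_nonneg_left (Real.exp_le_exp.2 ?_) (by positivity)
  rw [neg_mul, neg_mul, neg_le_neg_iff]
  gcongr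
  exact hi i hi'

/-- The inequality 2|ab| ≤ a² + b² reduces to two diagonal heat kernels. This controls the error of
replacing the filter by a polynomial. -/
theorem tsum_heat_abs_le (hX : IsDataSpace q μ lam φ) :
    ∃ κ : ℝ, 0 < κ ∧ ∀ (n : ℝ) (x y : X), 1 ≤ n →
      Summable (fun k => Real.exp (-(lam k / n) ^ 2) * |φ k x * φ k y|) ∧
      ∑' k, Real.exp (-(lam k / n) ^ 2) * |φ k x * φ k y| ≤ κ * n ^ q := by
  obtain ⟨κ₁, κ₂, h1, h2, H⟩ := hX.exists_heat_bound
  refine ⟨κ₁, h1, fun n x y hn => ?_⟩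
  have hn0 : 0 < n := by linarith
  have hxx := H n 1 hn le_rfl (by push_cast; nlinarith)
  simp only [pow_one] at hxx
  have hd : ∀ z : X, ∑' k, Real.exp (-(lam k / n) ^ 2) * (φ k z * φ k z) ≤ κ₁ * n ^ q := by
    intro z
    have := (hxx z z).2
    simp only [dist_self, ne_eq, OfNat.ofNat_ne_zero, not_false_eq_true, zero_pow, zero_mul,
      zero_div, mul_zero, Real.exp_zero, mul_one] at this
    exact (le_abs_self _).trans this
  have hle : ∀ k, Real.exp (-(lam k / n) ^ 2) * |φ k x * φ k y| ≤
      1 / 2 * (Real.exp (-(lam k / n) ^ 2) * (φ k x * φ k x) +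
        Real.exp (-(lam k / n) ^ 2) * (φ k y * φ k y)) := by
    intro k
    have : |φ k x * φ k y| ≤ 1 / 2 * (φ k x * φ k x + φ k y * φ k y) := by
      rw [abs_le]
      constructor <;> nlinarith [sq_nonneg (φ k x - φ k y), sq_nonneg (φ k x + φ k y)]
    calc _ ≤ Real.exp (-(lam k / n) ^ 2) * (1 / 2 * (φ k x * φ k x + φ k y * φ k y)) := by gcongr
      _ = _ := by ring
  have hs := ((hxx x x).1.add (hxx y y).1).mul_left (1 / 2 : ℝ)
  have hs' := Summable.of_nonneg_of_le (fun k => by positivity) hle hs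
  refine ⟨hs', (hs'.tsum_le_tsum hle hs).trans ?_⟩
  rw [tsum_mul_left, (hxx x x).1.tsum_add (hxx y y).1]
  linarith [hd x, hd y]

end IsDataSpace

/-! ### Localization of the kernels -/

/-- The two singularities are harmless: near u = 0 the filter vanishes, and near |u| = 1, where the
square root is not smooth, the filter is 1 and the function is 1/u. For |u| > 1 the square root is 0
by convention. -/
theorem IsLowPass.contDiff_comp_sqrt_log {h : ℝ → ℝ} (hh : IsLowPass h) :
    ContDiff ℝ ∞ (fun u => h (√(-Real.log u)) / u) := by
  rw [contDiff_iff_contDiffAt]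
  intro u
  by_cases hu : u = 0
  · subst hu
    refine (contDiffAt_const (c := (0 : ℝ))).congr_of_eventuallyEq ?_
    have h1 : ∀ᶠ v : ℝ in 𝓝[≠] 0, Real.log v < -1 :=
      Real.tendsto_log_nhdsNE_zero.eventually_lt_atBot (-1)
    rw [eventually_nhdsWithin_iff] at h1
    filter_upwards [h1] with v hv
    by_cases hv0 : v = 0
    · simp [hv0]
    · have := hv hv0
      rw [hh.eq_zero _ (Real.one_le_sqrt.2 (by linarith)), zero_div]
  · by_cases hl : Real.log u = 0
    · have hc : Tendsto Real.log (𝓝 u) (𝓝 0) := by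
        have := (Real.continuousAt_log hu).tendsto
        rwa [hl] at this
      refine (contDiffAt_inv ℝ hu).congr_of_eventuallyEq ?_
      filter_upwards [hc.eventually (lt_mem_nhds (by norm_num : (-(1 / 4) : ℝ) < 0))] with v hv
      rw [hh.eq_one, one_div]
      rw [abs_of_nonneg (Real.sqrt_nonneg _), Real.sqrt_le_left (by norm_num)]
      linarith
    · refine ContDiffAt.div ?_ contDiffAt_id hu
      refine hh.smooth.contDiffAt.comp u ?_
      exact ((Real.contDiffAt_log.2 hu).neg).sqrt (by simpa using hl)

theorem filter_eq_mul (h : ℝ → ℝ) {s : ℝ} (hs : 0 ≤ s) :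
    h s = h (√(-Real.log (Real.exp (-s ^ 2)))) / Real.exp (-s ^ 2) * Real.exp (-s ^ 2) := by
  rw [div_mul_cancel₀ _ (Real.exp_pos _).ne', Real.log_exp, neg_neg, Real.sqrt_sq hs]

namespace IsDataSpace

variable {X : Type*} [MetricSpace X] [MeasurableSpace X] {q : ℝ} {μ : Measure X} {lam : ℕ → ℝ}
  {φ : ℕ → C₀(X, ℝ)}

theorem exists_abs_kern_le (hX : IsDataSpace q μ lam φ) {h : ℝ → ℝ} (hh : IsLowPass h) :
    ∃ C : ℝ, 0 < C ∧ ∀ n : ℝ, 1 ≤ n → ∀ x y : X, |kern lam φ h n x y| ≤ C * n ^ q := by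
  obtain ⟨C, hC, H⟩ := hX.exists_christoffel_le
  refine ⟨C, hC, fun n hn x y => ?_⟩
  refine (abs_kern_le hX.lam_tendsto hh (by linarith) x y).trans ?_
  have h0 : 0 ≤ C * n ^ q := by positivity
  calc _ ≤ √(C * n ^ q) * √(C * n ^ q) := by
        gcongr
        · exact H n hn x
        · exact H n hn y
    _ = _ := Real.mul_self_sqrt h0

/-- The first term is the error of approximating χ by p, the second the kernel of p(T)T. The factor
u split off from the filter makes the error summable over all k. -/
theorem exists_kern_approx (hX : IsDataSpace q μ lam φ) {h : ℝ → ℝ} (hh : IsLowPass h) (S : ℕ) :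
    ∃ C κ : ℝ, 0 < C ∧ 0 < κ ∧ ∀ (n : ℝ) (J : ℕ), 1 ≤ n → (J : ℝ) + 1 ≤ n ^ 2 → ∀ x y : X,
      |kern lam φ h n x y| ≤ C * n ^ q * (1 / ((J : ℝ) + 1) ^ S +
        3 ^ J * Real.exp (-κ * (dist x y ^ 2 * n ^ 2 / (J + 1)))) := by
  obtain ⟨C, hC0, hC⟩ := exists_polynomial_approx hh.contDiff_comp_sqrt_log S
  obtain ⟨κ₁, κ₂, h1, h2, H⟩ := hX.exists_polynomial_kernel_bound
  obtain ⟨κ, hκ, H2⟩ := hX.tsum_heat_abs_le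
  refine ⟨C * κ + C * κ₁ + 1, κ₂, by positivity, h2, fun n J hn hJ x y => ?_⟩
  have hn0 : 0 < n := by linarith
  obtain ⟨p, hp, hpc, hpa⟩ := hC J
  obtain ⟨hs, hb⟩ := H n J p x y hn hJ hp
  obtain ⟨hs2, hb2⟩ := H2 n x y hn
  have hterm : ∀ k, |h (lam k / n) * φ k x * φ k y -
      p.eval (Real.exp (-(lam k / n) ^ 2)) * Real.exp (-(lam k / n) ^ 2) * (φ k x * φ k y)| ≤
        C / ((J : ℝ) + 1) ^ S * (Real.exp (-(lam k / n) ^ 2) * |φ k x * φ k y|) := by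
    intro k
    rw [filter_eq_mul h (div_nonneg (hX.lam_nonneg k) hn0.le)]
    set u := Real.exp (-(lam k / n) ^ 2) with hu
    have hu0 : 0 < u := Real.exp_pos _
    have hu1 : u ≤ 1 := by
      rw [hu, Real.exp_le_one_iff]; nlinarith [sq_nonneg (lam k / n)]
    have := hpa u ⟨by linarith, hu1⟩
    have e : h √(-Real.log u) / u * u * φ k x * φ k y - p.eval u * u * (φ k x * φ k y) =
        (h √(-Real.log u) / u - p.eval u) * (u * (φ k x * φ k y)) := by ring
    rw [e, abs_mul, abs_mul u, abs_of_pos hu0]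
    gcongr
  have hs3 : Summable fun k => h (lam k / n) * φ k x * φ k y := by
    refine summable_of_ne_finset_zero (s := lowIndices hX.lam_tendsto n) fun k hk => ?_
    rw [mem_lowIndices, not_lt] at hk
    rw [hh.eq_zero _ ((one_le_div hn0).2 hk)]
    simp
  have hdiff : |kern lam φ h n x y - ∑' k, p.eval (Real.exp (-(lam k / n) ^ 2)) *
      Real.exp (-(lam k / n) ^ 2) * (φ k x * φ k y)| ≤
        C / ((J : ℝ) + 1) ^ S * (κ * n ^ q) := by
    rw [kern, ← hs3.tsum_sub hs, ← Real.norm_eq_abs]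
    refine (tsum_of_norm_bounded (hs2.hasSum.mul_left _) hterm).trans ?_
    gcongr
  have h3 : |kern lam φ h n x y| ≤ C / ((J : ℝ) + 1) ^ S * (κ * n ^ q) +
      C * 3 ^ J * (κ₁ * n ^ q * Real.exp (-κ₂ * (dist x y ^ 2 * n ^ 2 / (J + 1)))) := by
    have h4 := abs_sub_abs_le_abs_sub (kern lam φ h n x y)
      (∑' k, p.eval (Real.exp (-(lam k / n) ^ 2)) * Real.exp (-(lam k / n) ^ 2) * (φ k x * φ k y))
    have h5 := hb.trans (mul_le_mul_of_nonneg_right hpc (by positivity))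
    linarith
  refine h3.trans ?_
  set E := Real.exp (-κ₂ * (dist x y ^ 2 * n ^ 2 / (J + 1)))
  have hE : 0 < E := Real.exp_pos _
  have hnq : 0 < n ^ q := Real.rpow_pos_of_pos hn0 q
  have hJS : 0 < 1 / ((J : ℝ) + 1) ^ S := by positivity
  calc _ = (C * κ) * n ^ q * (1 / ((J : ℝ) + 1) ^ S) + (C * κ₁) * n ^ q * (3 ^ J * E) := by ring
    _ ≤ (C * κ + C * κ₁ + 1) * n ^ q * (1 / ((J : ℝ) + 1) ^ S) +
        (C * κ + C * κ₁ + 1) * n ^ q * (3 ^ J * E) := by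
        have : 0 ≤ C * κ := by positivity
        have : 0 ≤ C * κ₁ := by positivity
        gcongr <;> linarith
    _ = _ := by ring

/-- The kernels `Φ_n` are localized around the diagonal, up to the distance `n`. -/
theorem exists_kern_localized (hX : IsDataSpace q μ lam φ) {h : ℝ → ℝ} (hh : IsLowPass h) (S : ℕ) :
    ∃ C : ℝ, 0 < C ∧ ∀ n : ℝ, 1 ≤ n → ∀ x y : X,
      |kern lam φ h n x y| ≤ C * n ^ q * (1 / (1 + n * min (dist x y) n) ^ S) := by
  obtain ⟨C₁, κ, hC₁, hκ, H1⟩ := hX.exists_kern_approx hh S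
  obtain ⟨C₂, hC₂, H2⟩ := hX.exists_abs_kern_le hh
  -- With J + 1 ≤ εnρ(x,y) this makes the Gaussian factor at most e^{-3(J+1)}, which beats 3^J ≤
  -- e^{2(J+1)}.
  obtain ⟨ε, hε0, hε1, hε⟩ : ∃ ε : ℝ, 0 < ε ∧ ε ≤ 1 ∧ 3 * ε ^ 2 ≤ κ := by
    refine ⟨min 1 (κ / 3), by positivity, min_le_left _ _, ?_⟩
    have h1 : min 1 (κ / 3) ≤ 1 := min_le_left _ _
    have h2 : min 1 (κ / 3) ≤ κ / 3 := min_le_right _ _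
    have h3 : 0 < min 1 (κ / 3) := by positivity
    nlinarith
  refine ⟨(C₁ * (1 + S.factorial) + C₂) * (4 / ε) ^ S, by positivity, fun n hn x y => ?_⟩
  have hn0 : 0 < n := by linarith
  have hnq : 0 < n ^ q := Real.rpow_pos_of_pos hn0 q
  -- Capping the distance at n keeps J + 1 ≤ n², so every heat time used is at most 1.
  set d := min (dist x y) n with hd
  have hd0 : 0 ≤ d := le_min dist_nonneg hn0.le
  have hdn : d ≤ n := min_le_right _ _
  have hdx : d ≤ dist x y := min_le_left _ _
  have hz0 : 0 ≤ n * d := by positivity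
  by_cases hcase : ε * (n * d) < 1
  · refine (H2 n hn x y).trans ?_
    have h1 : 1 + n * d ≤ 4 / ε := by
      rw [le_div_iff₀ hε0]; nlinarith
    have h2 : 1 ≤ (4 / ε) ^ S * (1 / (1 + n * d) ^ S) := by
      rw [mul_one_div, le_div_iff₀ (by positivity), one_mul]
      gcongr
    have h3 : C₂ ≤ C₁ * (1 + S.factorial) + C₂ := by
      have : 0 ≤ C₁ * (1 + (S.factorial : ℝ)) := by positivity
      linarith
    calc C₂ * n ^ q ≤ (C₁ * (1 + S.factorial) + C₂) * n ^ q * 1 := by rw [mul_one]; gcongr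
      _ ≤ (C₁ * (1 + S.factorial) + C₂) * n ^ q * ((4 / ε) ^ S * (1 / (1 + n * d) ^ S)) := by
        gcongr
      _ = _ := by ring
  · push Not at hcase
    obtain ⟨J, hJ⟩ : ∃ J : ℕ, ⌊ε * (n * d)⌋₊ = J + 1 :=
      Nat.exists_eq_succ_of_ne_zero (by
        have := Nat.one_le_floor_iff (ε * (n * d)) |>.2 hcase
        omega)
    have hJ1 : (J : ℝ) + 1 ≤ ε * (n * d) := by
      have := Nat.floor_le (show 0 ≤ ε * (n * d) by positivity)
      rw [hJ] at this
      exact_mod_cast this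
    have hJ2 : ε * (n * d) ≤ 2 * ((J : ℝ) + 1) := by
      have := Nat.lt_floor_add_one (ε * (n * d))
      rw [hJ] at this
      push_cast at this
      have : (0 : ℝ) ≤ J := Nat.cast_nonneg J
      linarith
    have hJ0 : (0 : ℝ) < (J : ℝ) + 1 := by positivity
    have hJn : (J : ℝ) + 1 ≤ n ^ 2 := by
      calc _ ≤ ε * (n * d) := hJ1
        _ ≤ 1 * (n * n) := by gcongr
        _ = n ^ 2 := by ring
    have hexp : (3 : ℝ) ^ J * Real.exp (-κ * (dist x y ^ 2 * n ^ 2 / (J + 1))) ≤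
        S.factorial * (1 / ((J : ℝ) + 1) ^ S) := by
      have h3 : (3 : ℝ) ^ J ≤ Real.exp (2 * ((J : ℝ) + 1)) := by
        have h31 : (3 : ℝ) ≤ Real.exp 2 := by
          have := Real.add_one_le_exp (2 : ℝ); linarith
        calc (3 : ℝ) ^ J ≤ (Real.exp 2) ^ J := by gcongr
          _ = Real.exp (2 * J) := by rw [← Real.exp_nat_mul]; ring_nf
          _ ≤ _ := Real.exp_le_exp.2 (by linarith)
      have h4 : -κ * (dist x y ^ 2 * n ^ 2 / (J + 1)) ≤ -(3 * ((J : ℝ) + 1)) := by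
        rw [neg_mul, neg_le_neg_iff, ← mul_div_assoc, le_div_iff₀ hJ0]
        have h5 : ((J : ℝ) + 1) * (J + 1) ≤ (ε * (n * dist x y)) * (ε * (n * dist x y)) := by
          have : ε * (n * d) ≤ ε * (n * dist x y) := by gcongr
          gcongr <;> linarith
        calc 3 * ((J : ℝ) + 1) * (J + 1) ≤ 3 * ((ε * (n * dist x y)) * (ε * (n * dist x y))) := by
              linarith
          _ = 3 * ε ^ 2 * (dist x y ^ 2 * n ^ 2) := by ring
          _ ≤ _ := by gcongr
      calc (3 : ℝ) ^ J * Real.exp (-κ * (dist x y ^ 2 * n ^ 2 / (J + 1))) ≤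
            Real.exp (2 * ((J : ℝ) + 1)) * Real.exp (-(3 * ((J : ℝ) + 1))) := by gcongr
        _ = Real.exp (-((J : ℝ) + 1)) := by rw [← Real.exp_add]; ring_nf
        _ ≤ _ := by
          have := Real.pow_div_factorial_le_exp ((J : ℝ) + 1) hJ0.le S
          rw [Real.exp_neg, mul_one_div, ← inv_div]
          exact inv_anti₀ (by positivity) this
    have hfin : 1 / ((J : ℝ) + 1) ^ S ≤ (4 / ε) ^ S * (1 / (1 + n * d) ^ S) := by
      rw [mul_one_div, div_le_div_iff₀ (by positivity) (by positivity), one_mul, ← mul_pow]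
      gcongr
      rw [div_mul_eq_mul_div, le_div_iff₀ hε0]
      nlinarith
    calc |kern lam φ h n x y| ≤ C₁ * n ^ q * (1 / ((J : ℝ) + 1) ^ S +
        3 ^ J * Real.exp (-κ * (dist x y ^ 2 * n ^ 2 / (J + 1)))) := H1 n J hn hJn x y
      _ ≤ C₁ * n ^ q * (1 / ((J : ℝ) + 1) ^ S + S.factorial * (1 / ((J : ℝ) + 1) ^ S)) := by gcongr
      _ = C₁ * (1 + S.factorial) * n ^ q * (1 / ((J : ℝ) + 1) ^ S) := by ring
      _ ≤ (C₁ * (1 + S.factorial) + C₂) * n ^ q * ((4 / ε) ^ S * (1 / (1 + n * d) ^ S)) := by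
        gcongr
        linarith
      _ = _ := by ring

end IsDataSpace

/-! ### Integrals of localized kernels -/

section

variable {X : Type*} [MetricSpace X] [MeasurableSpace X] [BorelSpace X]

/-- On the dyadic shell where 1 + nρ is about 2^j, the ball measure contributes 2^{jq} n^{-q} and
the integrand 2^{-jS}; S ≥ q + 1 leaves a geometric series. -/
theorem lintegral_localized_le {ν : Measure X} {q c : ℝ} {x : X} (hc : 0 ≤ c)
    (hν : ∀ r : ℝ, 0 < r → ν (Metric.closedBall x r) ≤ ENNReal.ofReal (c * r ^ q))
    {S : ℕ} (hS : q + 1 ≤ S) {n : ℝ} (hn : 0 < n) :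
    ∫⁻ y, ENNReal.ofReal (1 / (1 + n * dist x y) ^ S) ∂ν ≤
      ENNReal.ofReal (c * 2 ^ (q + 1) * n ^ (-q)) := by
  have hpt : ∀ y, ENNReal.ofReal (1 / (1 + n * dist x y) ^ S) ≤
      ∑' j : ℕ, (Metric.closedBall x ((2 : ℝ) ^ (j + 1) / n)).indicator
        (fun _ => ENNReal.ofReal (1 / ((2 : ℝ) ^ j) ^ S)) y := by
    intro y
    have h1 : (1 : ℝ) ≤ 1 + n * dist x y := by
      have : 0 ≤ n * dist x y := by positivity
      linarith
    obtain ⟨j, hj1, hj2⟩ := exists_nat_pow_near h1 (by norm_num : (1 : ℝ) < 2)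
    refine le_trans ?_ (ENNReal.le_tsum j)
    have hy : y ∈ Metric.closedBall x ((2 : ℝ) ^ (j + 1) / n) := by
      rw [Metric.mem_closedBall, dist_comm, le_div_iff₀ hn]
      linarith
    rw [Set.indicator_of_mem hy]
    apply ENNReal.ofReal_le_ofReal
    gcongr
  calc _ ≤ ∫⁻ y, ∑' j : ℕ, (Metric.closedBall x ((2 : ℝ) ^ (j + 1) / n)).indicator
        (fun _ => ENNReal.ofReal (1 / ((2 : ℝ) ^ j) ^ S)) y ∂ν := lintegral_mono hpt
    _ = ∑' j : ℕ, ENNReal.ofReal (1 / ((2 : ℝ) ^ j) ^ S) *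
          ν (Metric.closedBall x ((2 : ℝ) ^ (j + 1) / n)) := by
        rw [lintegral_tsum fun j =>
          (measurable_const.indicator Metric.isClosed_closedBall.measurableSet).aemeasurable]
        congr 1; funext j
        rw [lintegral_indicator_const Metric.isClosed_closedBall.measurableSet]
    _ ≤ ∑' j : ℕ, ENNReal.ofReal (c * 2 ^ q * n ^ (-q) * (1 / 2) ^ j) := by
        refine ENNReal.tsum_le_tsum fun j => ?_
        refine (mul_le_mul_right (hν _ (by positivity)) _).trans ?_
        rw [← ENNReal.ofReal_mul (by positivity)]
        apply ENNReal.ofReal_le_ofReal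
        have h2 : ((2 : ℝ) ^ (j + 1) / n) ^ q = 2 ^ q * ((2 : ℝ) ^ j) ^ q * n ^ (-q) := by
          rw [Real.div_rpow (by positivity) hn.le, pow_succ, Real.mul_rpow (by positivity)
            (by norm_num), Real.rpow_neg hn.le]
          field_simp
        have h3 : 1 / ((2 : ℝ) ^ j) ^ S * ((2 : ℝ) ^ j) ^ q ≤ (1 / 2) ^ j := by
          have h2j : (1 : ℝ) ≤ 2 ^ j := one_le_pow₀ (by norm_num)
          rw [one_div_pow, one_div_mul_eq_div, div_le_div_iff₀ (by positivity) (by positivity),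
            one_mul]
          calc ((2 : ℝ) ^ j) ^ q * 2 ^ j = ((2 : ℝ) ^ j) ^ (q + 1) := by
                rw [Real.rpow_add (by positivity), Real.rpow_one]
            _ ≤ ((2 : ℝ) ^ j) ^ (S : ℝ) := Real.rpow_le_rpow_of_exponent_le h2j hS
            _ = _ := Real.rpow_natCast _ _
        rw [h2]
        calc 1 / ((2 : ℝ) ^ j) ^ S * (c * (2 ^ q * ((2 : ℝ) ^ j) ^ q * n ^ (-q)))
            = c * 2 ^ q * n ^ (-q) * (1 / ((2 : ℝ) ^ j) ^ S * ((2 : ℝ) ^ j) ^ q) := by ring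
          _ ≤ _ := by gcongr
    _ = _ := by
        rw [← ENNReal.ofReal_tsum_of_nonneg (fun j => by positivity)
          (summable_geometric_two.mul_left _), tsum_mul_left, tsum_geometric_two,
          Real.rpow_add (by norm_num), Real.rpow_one]
        congr 1; ring

theorem one_div_one_add_mul_min_le {n ρ : ℝ} (hn : 1 ≤ n) (hρ : 0 ≤ ρ) (S : ℕ) :
    1 / (1 + n * min ρ n) ^ S ≤ 1 / (1 + n * ρ) ^ S + 1 / n ^ S := by
  have hn0 : 0 < n := by linarith
  rcases le_total ρ n with h | h
  · rw [min_eq_left h]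
    have : 0 ≤ 1 / n ^ S := by positivity
    linarith
  · rw [min_eq_right h]
    have h1 : 1 / (1 + n * n) ^ S ≤ 1 / n ^ S := by
      gcongr; nlinarith
    have : 0 ≤ 1 / (1 + n * ρ) ^ S := by positivity
    linarith

theorem rpow_div_pow_le_one {n r : ℝ} (hn : 1 ≤ n) {S : ℕ} (hS : r ≤ S) : n ^ r / n ^ S ≤ 1 := by
  rw [div_le_one (by positivity), ← Real.rpow_natCast]
  exact Real.rpow_le_rpow_of_exponent_le hn hS

end

namespace IsDataSpace

variable {X : Type*} [MetricSpace X] [MeasurableSpace X] [BorelSpace X] {q : ℝ} {μ : Measure X}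
  {lam : ℕ → ℝ} {φ : ℕ → C₀(X, ℝ)}

/-- Essential compactness at a large integer N ≥ n, with N ≤ (N₀ + 2)n, gives this for every real n
≥ 1, by monotonicity of the Christoffel function. The diameter bound puts K in a ball of polynomial
radius. -/
theorem exists_essential_compact (hX : IsDataSpace q μ lam φ) :
    ∃ (C : ℝ) (A : ℕ), 0 < C ∧ ∀ n : ℝ, 1 ≤ n → ∃ K : Set X, MeasurableSet K ∧
      μ K ≤ ENNReal.ofReal (C * n ^ A) ∧
      ENNReal.ofReal (n ^ (q / 2)) *
        ∫⁻ x in Kᶜ, ENNReal.ofReal √(christoffel lam φ n x) ∂μ ≤ 1 := by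
  obtain ⟨K, hK, ⟨c₁, c₂, hc₁, hc₂, hdiam⟩, -, hfast⟩ := hX.essential_compactness
  obtain ⟨κ, hκ, hball⟩ := hX.ball_measure
  have hq : 0 < q := by linarith [hX.one_le_q]
  have hev := (hfast (q / 2) (by positivity)).eventually (Iic_mem_nhds zero_lt_one)
  obtain ⟨N₀, hN₀⟩ := eventually_atTop.1 hev
  refine ⟨κ * (c₁ ^ q * ((N₀ + 2 : ℝ) ^ (c₂ * q))), ⌈c₂ * q⌉₊, by positivity, fun n hn => ?_⟩
  have hn0 : 0 < n := by linarith
  set N := max ⌈n⌉₊ N₀ with hN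
  have hnN : n ≤ N := (Nat.le_ceil n).trans (by exact_mod_cast le_max_left _ _)
  have hN1 : 1 ≤ N := by
    have : (1 : ℝ) ≤ N := hn.trans hnN
    exact_mod_cast this
  have hNn : (N : ℝ) ≤ (N₀ + 2) * n := by
    have h1 := (Nat.ceil_lt_add_one hn0.le).le
    have h2 : (0 : ℝ) ≤ N₀ := Nat.cast_nonneg _
    rw [hN]; push_cast
    exact max_le (by nlinarith) (by nlinarith)
  have hN0 : (0 : ℝ) < N := by linarith
  refine ⟨K N, (hK N hN1).isClosed.measurableSet, ?_, ?_⟩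
  · rcases (K N).eq_empty_or_nonempty with he | ⟨x₀, hx₀⟩
    · rw [he]; simp
    · have hr : 0 < c₁ * (N : ℝ) ^ c₂ := by positivity
      have hsub : K N ⊆ Metric.closedBall x₀ (c₁ * (N : ℝ) ^ c₂) := fun y hy =>
        (Metric.dist_le_diam_of_mem (hK N hN1).isBounded hy hx₀).trans (hdiam N hN1)
      refine (measure_mono hsub).trans ?_
      rw [(hball x₀ _ hr).1]
      refine (hball x₀ _ hr).2.trans (ENNReal.ofReal_le_ofReal ?_)
      rw [mul_assoc]
      refine mul_le_mul_of_nonneg_left ?_ hκ.le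
      rw [Real.mul_rpow hc₁.le (by positivity), ← Real.rpow_mul hN0.le, mul_assoc]
      refine mul_le_mul_of_nonneg_left ?_ (by positivity)
      calc (N : ℝ) ^ (c₂ * q) ≤ ((N₀ + 2) * n) ^ (c₂ * q) := by gcongr
        _ = (N₀ + 2 : ℝ) ^ (c₂ * q) * n ^ (c₂ * q) := Real.mul_rpow (by positivity) hn0.le
        _ ≤ _ := by
          refine mul_le_mul_of_nonneg_left ?_ (by positivity)
          rw [← Real.rpow_natCast]
          exact Real.rpow_le_rpow_of_exponent_le hn (Nat.le_ceil _)
  · refine le_trans ?_ (hN₀ N (le_max_right _ _))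
    refine mul_le_mul' (by gcongr) (lintegral_mono fun x => ENNReal.ofReal_le_ofReal
      (Real.sqrt_le_sqrt ?_))
    exact christoffel_mono hX.lam_tendsto hnN x

theorem exists_lintegral_sqrt_christoffel_le (hX : IsDataSpace q μ lam φ) :
    ∃ (C : ℝ) (A : ℕ), 0 < C ∧ ∀ n : ℝ, 1 ≤ n →
      ∫⁻ x, ENNReal.ofReal √(christoffel lam φ n x) ∂μ ≤ ENNReal.ofReal (C * n ^ A) := by
  obtain ⟨C, A, hC, H⟩ := hX.exists_essential_compact
  obtain ⟨D, hD, H2⟩ := hX.exists_christoffel_le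
  have hq : 0 < q := by linarith [hX.one_le_q]
  refine ⟨√D * C + 1, A + ⌈q⌉₊, by positivity, fun n hn => ?_⟩
  have hn0 : 0 < n := by linarith
  obtain ⟨K, hK, hμ, hI⟩ := H n hn
  rw [← lintegral_add_compl _ hK]
  have h1 : ∫⁻ x in K, ENNReal.ofReal √(christoffel lam φ n x) ∂μ ≤
      ENNReal.ofReal (√D * C * n ^ (A + ⌈q⌉₊)) := by
    calc _ ≤ ∫⁻ x in K, ENNReal.ofReal (√D * n ^ ⌈q⌉₊) ∂μ := by
          gcongr with x
          have h2 : n ^ q ≤ (n ^ ⌈q⌉₊) ^ 2 := by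
            have h3 : n ^ q ≤ n ^ ⌈q⌉₊ := by
              rw [← Real.rpow_natCast]
              exact Real.rpow_le_rpow_of_exponent_le hn (Nat.le_ceil _)
            have h4 : 1 ≤ n ^ ⌈q⌉₊ := one_le_pow₀ hn
            nlinarith
          calc √(christoffel lam φ n x) ≤ √(D * (n ^ ⌈q⌉₊) ^ 2) := by
                apply Real.sqrt_le_sqrt
                refine (H2 n hn x).trans ?_
                gcongr
            _ = _ := by rw [Real.sqrt_mul hD.le, Real.sqrt_sq (by positivity)]
      _ = ENNReal.ofReal (√D * n ^ ⌈q⌉₊) * μ K := by rw [setLIntegral_const]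
      _ ≤ ENNReal.ofReal (√D * n ^ ⌈q⌉₊) * ENNReal.ofReal (C * n ^ A) := by gcongr
      _ = _ := by
        rw [← ENNReal.ofReal_mul (by positivity)]
        congr 1; ring
  have h2 : ∫⁻ x in Kᶜ, ENNReal.ofReal √(christoffel lam φ n x) ∂μ ≤
      ENNReal.ofReal (1 * n ^ (A + ⌈q⌉₊)) := by
    calc _ ≤ ENNReal.ofReal (n ^ (q / 2)) *
          ∫⁻ x in Kᶜ, ENNReal.ofReal √(christoffel lam φ n x) ∂μ := by
          refine le_mul_of_one_le_left zero_le (ENNReal.one_le_ofReal.2 ?_)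
          exact Real.one_le_rpow hn (by positivity)
      _ ≤ 1 := hI
      _ ≤ _ := ENNReal.one_le_ofReal.2 (by rw [one_mul]; exact one_le_pow₀ hn)
  refine (add_le_add h1 h2).trans ?_
  rw [← ENNReal.ofReal_add (by positivity) (by positivity)]
  apply le_of_eq; congr 1; ring

theorem exists_lintegral_abs_kern_le (hX : IsDataSpace q μ lam φ) {h : ℝ → ℝ} (hh : IsLowPass h) :
    ∃ L : ℝ, 0 < L ∧ ∀ n : ℝ, 1 ≤ n → ∀ x : X,
      ∫⁻ y, ENNReal.ofReal |kern lam φ h n x y| ∂μ ≤ ENNReal.ofReal L := by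
  obtain ⟨C, A, hC, H⟩ := hX.exists_essential_compact
  obtain ⟨D, hD, H2⟩ := hX.exists_christoffel_le
  obtain ⟨κ, hκ, hball⟩ := hX.ball_measure
  have hq : 0 < q := by linarith [hX.one_le_q]
  -- The capped distance leaves an error n^{-S} that must beat n^q μ(K), of order n^{q+A}.
  set S := ⌈q⌉₊ + 1 + A with hS
  have hqS : q + 1 + A ≤ S := by
    rw [hS]; push_cast; linarith [Nat.le_ceil q]
  have hA0 : (0 : ℝ) ≤ A := Nat.cast_nonneg _
  obtain ⟨E, hE, H3⟩ := hX.exists_kern_localized hh S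
  refine ⟨E * (κ * 2 ^ (q + 1)) + E * C + √D, by positivity, fun n hn x => ?_⟩
  have hn0 : 0 < n := by linarith
  obtain ⟨K, hK, hμ, hI⟩ := H n hn
  rw [← lintegral_add_compl _ hK]
  have h1 : ∫⁻ y in K, ENNReal.ofReal |kern lam φ h n x y| ∂μ ≤
      ENNReal.ofReal (E * (κ * 2 ^ (q + 1)) + E * C) := by
    have hν : ∀ r : ℝ, 0 < r → μ (Metric.closedBall x r) ≤ ENNReal.ofReal (κ * r ^ q) :=
      fun r hr => by rw [(hball x r hr).1]; exact (hball x r hr).2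
    calc _ ≤ ∫⁻ y in K, (ENNReal.ofReal (E * n ^ q) *
          ENNReal.ofReal (1 / (1 + n * dist x y) ^ S) + ENNReal.ofReal (E * n ^ q * (1 / n ^ S)))
            ∂μ := by
          gcongr with y
          rw [← ENNReal.ofReal_mul (by positivity), ← ENNReal.ofReal_add (by positivity)
            (by positivity), ← mul_add]
          apply ENNReal.ofReal_le_ofReal
          refine (H3 n hn x y).trans ?_
          gcongr
          exact one_div_one_add_mul_min_le hn dist_nonneg S
      _ = ENNReal.ofReal (E * n ^ q) * ∫⁻ y in K, ENNReal.ofReal (1 / (1 + n * dist x y) ^ S) ∂μ +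
            ENNReal.ofReal (E * n ^ q * (1 / n ^ S)) * μ K := by
          rw [lintegral_add_right _ measurable_const, setLIntegral_const,
            lintegral_const_mul' _ _ ENNReal.ofReal_ne_top]
      _ ≤ ENNReal.ofReal (E * n ^ q) * ENNReal.ofReal (κ * 2 ^ (q + 1) * n ^ (-q)) +
            ENNReal.ofReal (E * n ^ q * (1 / n ^ S)) * ENNReal.ofReal (C * n ^ A) := by
          gcongr
          exact (setLIntegral_le_lintegral _ _).trans
            (lintegral_localized_le hκ.le hν (by linarith) hn0)
      _ ≤ _ := by
          rw [← ENNReal.ofReal_mul (by positivity), ← ENNReal.ofReal_mul (by positivity),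
            ← ENNReal.ofReal_add (by positivity) (by positivity)]
          apply ENNReal.ofReal_le_ofReal
          have e1 : n ^ q * n ^ (-q) = 1 := by rw [← Real.rpow_add hn0]; simp
          have e2 : n ^ (q + A) / n ^ S ≤ 1 := rpow_div_pow_le_one hn (by linarith)
          have e3 : n ^ (q + A) = n ^ q * n ^ A := by rw [Real.rpow_add hn0, Real.rpow_natCast]
          calc _ = E * (κ * 2 ^ (q + 1)) * (n ^ q * n ^ (-q)) +
                E * C * ((n ^ q * n ^ A) / n ^ S) := by ring
            _ ≤ E * (κ * 2 ^ (q + 1)) * 1 + E * C * 1 := by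
                rw [e1, ← e3]; gcongr
            _ = _ := by ring
  have h2 : ∫⁻ y in Kᶜ, ENNReal.ofReal |kern lam φ h n x y| ∂μ ≤ ENNReal.ofReal √D := by
    have e : √(n ^ q) = n ^ (q / 2) := by
      rw [Real.sqrt_eq_rpow, ← Real.rpow_mul hn0.le]; congr 1; ring
    calc _ ≤ ∫⁻ y in Kᶜ, ENNReal.ofReal √D * (ENNReal.ofReal (n ^ (q / 2)) *
          ENNReal.ofReal √(christoffel lam φ n y)) ∂μ := by
          gcongr with y
          rw [← ENNReal.ofReal_mul (by positivity), ← ENNReal.ofReal_mul (by positivity),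
            ← mul_assoc]
          apply ENNReal.ofReal_le_ofReal
          refine (abs_kern_le hX.lam_tendsto hh hn0 x y).trans ?_
          gcongr
          rw [← e, ← Real.sqrt_mul hD.le]
          exact Real.sqrt_le_sqrt (H2 n hn x)
      _ = ENNReal.ofReal √D * (ENNReal.ofReal (n ^ (q / 2)) *
          ∫⁻ y in Kᶜ, ENNReal.ofReal √(christoffel lam φ n y) ∂μ) := by
          rw [lintegral_const_mul' _ _ ENNReal.ofReal_ne_top,
            lintegral_const_mul' _ _ ENNReal.ofReal_ne_top]
      _ ≤ ENNReal.ofReal √D * 1 := by gcongr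
      _ = _ := mul_one _
  refine (add_le_add h1 h2).trans ?_
  rw [← ENNReal.ofReal_add (by positivity) (by positivity)]

/-- One factor of the kernel is bounded by n^q, the other by localization. The error from the capped
distance has no factor R; a ≤ R supplies it. -/
theorem exists_lintegral_kern_sq_le (hX : IsDataSpace q μ lam φ) {h : ℝ → ℝ} (hh : IsLowPass h)
    {a : ℝ} (ha : 0 < a) :
    ∃ C : ℝ, 0 < C ∧ ∀ (ν : Measure X) [IsProbabilityMeasure ν] (R : ℝ), a ≤ R →
      (∀ (x : X) (r : ℝ), 0 < r → ν (Metric.closedBall x r) ≤ ENNReal.ofReal (R * r ^ q)) →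
      ∀ n : ℝ, 1 ≤ n → ∀ x : X,
        ∫⁻ y, ENNReal.ofReal (kern lam φ h n x y ^ 2) ∂ν ≤ ENNReal.ofReal (C * (n ^ q * R)) := by
  obtain ⟨D, hD, H2⟩ := hX.exists_abs_kern_le hh
  have hq : 0 < q := by linarith [hX.one_le_q]
  set S := ⌈q⌉₊ + 1 with hS
  have hqS : q + 1 ≤ S := by
    rw [hS]; push_cast; linarith [Nat.le_ceil q]
  obtain ⟨E, hE, H3⟩ := hX.exists_kern_localized hh S
  refine ⟨D * E * (2 ^ (q + 1) + 1 / a), by positivity, fun ν _ R hR hν n hn x => ?_⟩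
  have hn0 : 0 < n := by linarith
  have hR0 : 0 < R := by linarith
  calc _ ≤ ∫⁻ y, (ENNReal.ofReal (D * n ^ q * (E * n ^ q)) *
          ENNReal.ofReal (1 / (1 + n * dist x y) ^ S) +
            ENNReal.ofReal (D * n ^ q * (E * n ^ q) * (1 / n ^ S))) ∂ν := by
        gcongr with y
        rw [← ENNReal.ofReal_mul (by positivity), ← ENNReal.ofReal_add (by positivity)
          (by positivity), ← mul_add]
        apply ENNReal.ofReal_le_ofReal
        rw [← sq_abs, pow_two, mul_assoc (D * n ^ q)]
        refine mul_le_mul (H2 n hn x y) ((H3 n hn x y).trans ?_) (abs_nonneg _) (by positivity)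
        gcongr
        exact one_div_one_add_mul_min_le hn dist_nonneg S
    _ = ENNReal.ofReal (D * n ^ q * (E * n ^ q)) *
          ∫⁻ y, ENNReal.ofReal (1 / (1 + n * dist x y) ^ S) ∂ν +
            ENNReal.ofReal (D * n ^ q * (E * n ^ q) * (1 / n ^ S)) := by
        rw [lintegral_add_right _ measurable_const, lintegral_const, measure_univ, mul_one,
          lintegral_const_mul' _ _ ENNReal.ofReal_ne_top]
    _ ≤ ENNReal.ofReal (D * n ^ q * (E * n ^ q)) * ENNReal.ofReal (R * 2 ^ (q + 1) * n ^ (-q)) +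
          ENNReal.ofReal (D * n ^ q * (E * n ^ q) * (1 / n ^ S)) := by
        gcongr
        exact lintegral_localized_le hR0.le (hν x) hqS hn0
    _ ≤ _ := by
        rw [← ENNReal.ofReal_mul (by positivity), ← ENNReal.ofReal_add (by positivity)
          (by positivity)]
        apply ENNReal.ofReal_le_ofReal
        have e1 : n ^ q * n ^ (-q) = 1 := by rw [← Real.rpow_add hn0]; simp
        have e2 : n ^ q / n ^ S ≤ 1 := rpow_div_pow_le_one hn (by linarith)
        have e3 : 1 ≤ 1 / a * R := by rw [one_div_mul_eq_div, one_le_div ha]; exact hR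
        calc _ = D * E * n ^ q * (R * 2 ^ (q + 1) * (n ^ q * n ^ (-q)) + n ^ q / n ^ S) := by ring
          _ ≤ D * E * n ^ q * (R * 2 ^ (q + 1) * 1 + 1 / a * R) := by
              rw [e1]; gcongr; exact e2.trans e3
          _ = _ := by ring

end IsDataSpace

/-! ### Bernstein's inequality -/

section

variable {Z : Type*} [MeasurableSpace Z] {τ : Measure Z} [IsProbabilityMeasure τ]

/-- From e^v ≤ 1 + v + v² for |v| ≤ 1. The uncentred second moment suffices. -/
theorem integral_exp_mul_le {Y : Z → ℝ} (hY : Measurable Y) {β V s : ℝ}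
    (hβ : ∀ z, |Y z| ≤ β) (hV : ∫ z, Y z ^ 2 ∂τ ≤ V) (hs : 0 ≤ s) (hsβ : s * β ≤ 1) :
    ∫ z, Real.exp (s * Y z) ∂τ ≤ Real.exp (s * ∫ z, Y z ∂τ + s ^ 2 * V) := by
  have hYi : Integrable Y τ :=
    Integrable.of_bound hY.aestronglyMeasurable β (ae_of_all _ hβ)
  have hY2i : Integrable (fun z => Y z ^ 2) τ := by
    refine Integrable.of_bound (hY.pow_const 2).aestronglyMeasurable (β ^ 2) (ae_of_all _ fun z => ?_)
    rw [norm_pow, Real.norm_eq_abs]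
    exact pow_le_pow_left₀ (abs_nonneg _) (hβ z) 2
  have h1 : ∀ z, Real.exp (s * Y z) ≤ 1 + s * Y z + s ^ 2 * Y z ^ 2 := by
    intro z
    have hz : |s * Y z| ≤ 1 := by
      rw [abs_mul, abs_of_nonneg hs]
      exact (mul_le_mul_of_nonneg_left (hβ z) hs).trans hsβ
    have := (abs_le.1 (Real.abs_exp_sub_one_sub_id_le hz)).2
    rw [mul_pow] at this
    linarith
  have hi1 : Integrable (fun z => 1 + s * Y z) τ := (integrable_const _).add (hYi.const_mul s)
  calc ∫ z, Real.exp (s * Y z) ∂τ ≤ ∫ z, (1 + s * Y z + s ^ 2 * Y z ^ 2) ∂τ :=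
        integral_mono_of_nonneg (ae_of_all _ fun z => Real.exp_nonneg _)
          (hi1.add (hY2i.const_mul _)) (ae_of_all _ h1)
    _ = 1 + s * ∫ z, Y z ∂τ + s ^ 2 * ∫ z, Y z ^ 2 ∂τ := by
        rw [integral_add hi1 (hY2i.const_mul _), integral_add (integrable_const _)
          (hYi.const_mul s), integral_const_mul, integral_const_mul]
        simp
    _ ≤ s * ∫ z, Y z ∂τ + s ^ 2 * V + 1 := by
        have := mul_le_mul_of_nonneg_left hV (sq_nonneg s)
        linarith
    _ ≤ _ := Real.add_one_le_exp _

theorem pi_mean_sub_ge_le {Y : Z → ℝ} (hY : Measurable Y) {β V t : ℝ}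
    (hβ : ∀ z, |Y z| ≤ β) (hV : ∫ z, Y z ^ 2 ∂τ ≤ V) (hV0 : 0 < V) (ht : 0 < t)
    (htβ : t * β ≤ 2 * V) {M : ℕ} (hM : 0 < M) :
    (Measure.pi fun _ : Fin M => τ).real
      {z | t ≤ (1 / (M : ℝ)) * ∑ j, Y (z j) - ∫ w, Y w ∂τ} ≤ Real.exp (-(M * t ^ 2 / (4 * V))) := by
  -- This minimizes -st + s²V, with value -t²/(4V); `htβ` is exactly sβ ≤ 1.
  set s := t / (2 * V) with hs
  have hs0 : 0 < s := by positivity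
  have hsβ : s * β ≤ 1 := by
    rw [hs, div_mul_eq_mul_div, div_le_one (by positivity)]; exact htβ
  have hM0 : (0 : ℝ) < M := by exact_mod_cast hM
  set m := ∫ w, Y w ∂τ with hm
  have hsub : {z : Fin M → Z | t ≤ (1 / (M : ℝ)) * ∑ j, Y (z j) - m} ⊆
      {z | M * (t + m) ≤ ∑ j, Y (z j)} := by
    intro z hz
    simp only [Set.mem_ofPred_eq] at hz ⊢
    have : t + m ≤ (1 / (M : ℝ)) * ∑ j, Y (z j) := by linarith
    rw [one_div_mul_eq_div, le_div_iff₀ hM0] at this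
    linarith
  have hei : Integrable (fun z => Real.exp (s * Y z)) τ := by
    refine Integrable.of_bound (hY.const_mul s).exp.aestronglyMeasurable (Real.exp 1)
      (ae_of_all _ fun z => ?_)
    rw [Real.norm_of_nonneg (Real.exp_nonneg _)]
    apply Real.exp_le_exp.2
    exact (mul_le_mul_of_nonneg_left ((le_abs_self _).trans (hβ z)) hs0.le).trans hsβ
  have e : (fun z : Fin M → Z => Real.exp (s * ∑ j, Y (z j))) =
      fun z => ∏ j, Real.exp (s * Y (z j)) := by
    funext z; rw [Finset.mul_sum, Real.exp_sum]
  have hint : Integrable (fun z : Fin M → Z => Real.exp (s * ∑ j, Y (z j)))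
      (Measure.pi fun _ : Fin M => τ) := by
    rw [e]; exact Integrable.fintype_prod (f := fun _ w => Real.exp (s * Y w)) fun _ => hei
  have hmgf := ProbabilityTheory.measure_ge_le_exp_mul_mgf
    (μ := Measure.pi fun _ : Fin M => τ) (X := fun z => ∑ j, Y (z j)) (M * (t + m)) hs0.le hint
  refine (measureReal_mono hsub).trans (hmgf.trans ?_)
  rw [ProbabilityTheory.mgf, e,
    integral_fintype_prod_eq_prod (fun _ w => Real.exp (s * Y w)),
    Finset.prod_const, Finset.card_univ, Fintype.card_fin]
  have h1 := integral_exp_mul_le hY hβ hV hs0.le hsβ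
  calc _ ≤ Real.exp (-s * (M * (t + m))) * Real.exp (s * m + s ^ 2 * V) ^ M := by
        gcongr
    _ = Real.exp (-(M * t ^ 2 / (4 * V))) := by
        rw [← Real.exp_nat_mul, ← Real.exp_add]
        congr 1
        rw [hs]; field_simp; ring

theorem pi_abs_mean_sub_ge_le {Y : Z → ℝ} (hY : Measurable Y) {β V t : ℝ}
    (hβ : ∀ z, |Y z| ≤ β) (hV : ∫ z, Y z ^ 2 ∂τ ≤ V) (hV0 : 0 < V) (ht : 0 < t)
    (htβ : t * β ≤ 2 * V) {M : ℕ} (hM : 0 < M) :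
    (Measure.pi fun _ : Fin M => τ)
      {z | t ≤ |(1 / (M : ℝ)) * ∑ j, Y (z j) - ∫ w, Y w ∂τ|} ≤
        ENNReal.ofReal (2 * Real.exp (-(M * t ^ 2 / (4 * V)))) := by
  have h1 := pi_mean_sub_ge_le hY hβ hV hV0 ht htβ hM
  have h2 := pi_mean_sub_ge_le (τ := τ) (Y := fun z => -Y z) hY.neg (by simpa using hβ)
    (by simpa using hV) hV0 ht htβ hM
  have hsub : {z : Fin M → Z | t ≤ |(1 / (M : ℝ)) * ∑ j, Y (z j) - ∫ w, Y w ∂τ|} ⊆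
      {z | t ≤ (1 / (M : ℝ)) * ∑ j, Y (z j) - ∫ w, Y w ∂τ} ∪
      {z | t ≤ (1 / (M : ℝ)) * ∑ j, -Y (z j) - ∫ w, -Y w ∂τ} := by
    intro z hz
    rcases le_abs.1 (Set.mem_ofPred.1 hz) with h | h
    · exact Or.inl h
    · refine Or.inr ?_
      simp only [Set.mem_ofPred_eq, Finset.sum_neg_distrib, integral_neg]
      linarith
  rw [← ENNReal.ofReal_toReal (measure_ne_top _ _)]
  apply ENNReal.ofReal_le_ofReal
  refine (measureReal_mono hsub).trans ((measureReal_union_le _ _).trans ?_)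
  linarith

end

/-! ### Norms of diffusion polynomials -/

namespace IsDataSpace

variable {X : Type*} [MetricSpace X] [MeasurableSpace X] [BorelSpace X] {q : ℝ} {μ : Measure X}
  {lam : ℕ → ℝ} {φ : ℕ → C₀(X, ℝ)}

theorem integrable_mul (hX : IsDataSpace q μ lam φ) (j k : ℕ) :
    Integrable (fun x => φ j x * φ k x) μ := by
  refine (hX.integrable k).bdd_mul (c := ‖φ j‖) (φ j).continuous.aestronglyMeasurable
    (ae_of_all _ fun x => ?_)
  exact (φ j).toBCF.norm_coe_le_norm x

/-- The order is doubled because λ_k < n puts λ_k/(2n) where the filter equals 1. -/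
theorem integral_kern_mul (hX : IsDataSpace q μ lam φ) {h : ℝ → ℝ} (hh : IsLowPass h) {n : ℝ}
    (hn : 0 < n) (α : ℕ → ℝ) (x : X) :
    ∫ y, kern lam φ h (2 * n) x y * ∑ k ∈ lowIndices hX.lam_tendsto n, α k * φ k y ∂μ =
      ∑ k ∈ lowIndices hX.lam_tendsto n, α k * φ k x := by
  have hl := hX.lam_tendsto
  have e : ∀ y, kern lam φ h (2 * n) x y * ∑ k ∈ lowIndices hl n, α k * φ k y =
      ∑ k ∈ lowIndices hl n, ∑ j ∈ lowIndices hl (2 * n),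
        α k * (h (lam j / (2 * n)) * φ j x) * (φ j y * φ k y) := by
    intro y
    rw [kern_eq_sum hl hh (by linarith), Finset.mul_sum]
    refine Finset.sum_congr rfl fun k _ => ?_
    rw [Finset.sum_mul]
    refine Finset.sum_congr rfl fun j _ => ?_
    ring
  simp_rw [e]
  rw [integral_finsetSum _ fun k _ => integrable_finsetSum _ fun j _ =>
    (hX.integrable_mul j k).const_mul _]
  refine Finset.sum_congr rfl fun k hk => ?_
  rw [integral_finsetSum _ fun j _ => (hX.integrable_mul j k).const_mul _]
  simp_rw [integral_const_mul, hX.orthonormal]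
  have hkn : lam k < n := (mem_lowIndices hl).1 hk
  rw [Finset.sum_eq_single k]
  · have h0 := hX.lam_nonneg k
    rw [if_pos rfl, mul_one, hh.eq_one, one_mul]
    rw [abs_of_nonneg (by positivity), div_le_iff₀ (by positivity)]
    linarith
  · intro j _ hjk
    rw [if_neg hjk, mul_zero]
  · intro hk'
    exact absurd ((mem_lowIndices hl).2 (by linarith)) hk'

/-- A diffusion polynomial which is small off a small set is small everywhere. -/
theorem exists_sup_le_of_measure_le (hX : IsDataSpace q μ lam φ) {h : ℝ → ℝ} (hh : IsLowPass h) :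
    ∃ L C : ℝ, 0 < L ∧ 0 < C ∧ ∀ (n : ℝ) (α : ℕ → ℝ) (t : ℝ), 1 ≤ n → 0 ≤ t →
      ENNReal.ofReal (C * n ^ q) *
        μ {x | t ≤ |∑ k ∈ lowIndices hX.lam_tendsto n, α k * φ k x|} ≤ ENNReal.ofReal (1 / 2) →
      ∀ x, |∑ k ∈ lowIndices hX.lam_tendsto n, α k * φ k x| ≤ 2 * L * t := by
  obtain ⟨L, hL, HL⟩ := hX.exists_lintegral_abs_kern_le hh
  obtain ⟨D, hD, HD⟩ := hX.exists_abs_kern_le hh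
  refine ⟨L, D * 2 ^ q, hL, by positivity, fun n α t hn ht hμ x₀ => ?_⟩
  have hn0 : 0 < n := by linarith
  set P : X → ℝ := fun x => ∑ k ∈ lowIndices hX.lam_tendsto n, α k * φ k x with hP
  have hPc : Continuous P := continuous_finsetSum _ fun k _ => continuous_const.mul (φ k).continuous
  set U : Set X := {x | t ≤ |P x|} with hU
  have hUm : MeasurableSet U := (isClosed_le continuous_const hPc.abs).measurableSet
  -- Off U the L¹ bound of the kernel gives Lt; on U its sup bound times μ(U) costs at most half of
  -- G. With G the finite supremum of |P|, that half is absorbed.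
  have step : ∀ G : ℝ, 0 ≤ G → (∀ x, |P x| ≤ G) → ∀ x, |P x| ≤ L * t + 1 / 2 * G := by
    intro G hG0 hG x
    have hrep : ∫ y, kern lam φ h (2 * n) x y * P y ∂μ = P x := hX.integral_kern_mul hh hn0 α x
    have h1 : ENNReal.ofReal |P x| ≤ ENNReal.ofReal (L * t + 1 / 2 * G) := by
      calc ENNReal.ofReal |P x| = ‖∫ y, kern lam φ h (2 * n) x y * P y ∂μ‖ₑ := by
            rw [hrep, Real.enorm_eq_ofReal_abs]
        _ ≤ ∫⁻ y, ‖kern lam φ h (2 * n) x y * P y‖ₑ ∂μ := enorm_integral_le_lintegral_enorm _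
        _ ≤ ∫⁻ y, (ENNReal.ofReal |kern lam φ h (2 * n) x y| * ENNReal.ofReal t +
              U.indicator (fun _ => ENNReal.ofReal (D * (2 * n) ^ q * G)) y) ∂μ := by
            refine lintegral_mono fun y => ?_
            rw [Real.enorm_eq_ofReal_abs, abs_mul]
            by_cases hy : y ∈ U
            · rw [Set.indicator_of_mem hy]
              refine le_trans (ENNReal.ofReal_le_ofReal ?_) le_add_self
              refine mul_le_mul (HD _ (by linarith) x y) (hG y) (abs_nonneg _) (by positivity)
            · rw [Set.indicator_of_notMem hy, add_zero, ← ENNReal.ofReal_mul (abs_nonneg _)]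
              apply ENNReal.ofReal_le_ofReal
              refine mul_le_mul_of_nonneg_left ?_ (abs_nonneg _)
              simp only [hU, Set.mem_ofPred_eq, not_le] at hy
              exact hy.le
        _ = (∫⁻ y, ENNReal.ofReal |kern lam φ h (2 * n) x y| ∂μ) * ENNReal.ofReal t +
              ENNReal.ofReal (D * (2 * n) ^ q * G) * μ U := by
            rw [lintegral_add_right _ (measurable_const.indicator hUm),
              lintegral_mul_const' _ _ ENNReal.ofReal_ne_top, lintegral_indicator_const hUm]
        _ ≤ ENNReal.ofReal L * ENNReal.ofReal t +
              ENNReal.ofReal G * (ENNReal.ofReal (D * 2 ^ q * n ^ q) * μ U) := by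
            refine add_le_add (mul_le_mul' (HL _ (by linarith) x) le_rfl) (le_of_eq ?_)
            rw [← mul_assoc, ← ENNReal.ofReal_mul hG0, Real.mul_rpow (by norm_num) hn0.le]
            congr 2; ring
        _ ≤ ENNReal.ofReal L * ENNReal.ofReal t +
              ENNReal.ofReal G * ENNReal.ofReal (1 / 2) := by gcongr
        _ = _ := by
            rw [← ENNReal.ofReal_mul hL.le, ← ENNReal.ofReal_mul hG0,
              ← ENNReal.ofReal_add (by positivity) (by positivity)]
            congr 1; ring
    exact (ENNReal.ofReal_le_ofReal_iff (by positivity)).1 h1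
  have hbdd : BddAbove (Set.range fun x => |P x|) := by
    refine ⟨∑ k ∈ lowIndices hX.lam_tendsto n, |α k| * ‖φ k‖, ?_⟩
    rintro _ ⟨x, rfl⟩
    refine (Finset.abs_sum_le_sum_abs _ _).trans (Finset.sum_le_sum fun k _ => ?_)
    rw [abs_mul]
    exact mul_le_mul_of_nonneg_left ((φ k).toBCF.norm_coe_le_norm x) (abs_nonneg _)
  have : Nonempty X := ⟨x₀⟩
  have hG : ∀ x, |P x| ≤ ⨆ x, |P x| := fun x => le_ciSup hbdd x
  have hG2 := ciSup_le (step _ ((abs_nonneg _).trans (hG x₀)) hG)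
  have := hG x₀
  change |P x₀| ≤ _
  linarith

end IsDataSpace

/-! ### Random sampling -/

section

variable {X : Type*} [MetricSpace X] [MeasurableSpace X]

/-- The infimum is attained. It is 0 by convention if no constant is admissible, so positivity is
what guarantees an admissible one. -/
theorem measure_closedBall_le_regularNorm {ν : Measure X} [IsFiniteMeasure ν] {q : ℝ}
    (h : 0 < regularNorm q 0 ν) (x : X) {r : ℝ} (hr : 0 < r) :
    ν (Metric.closedBall x r) ≤ ENNReal.ofReal (regularNorm q 0 ν * r ^ q) := by
  have hrq : 0 < r ^ q := Real.rpow_pos_of_pos hr q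
  have hne : {c : ℝ | 0 ≤ c ∧ ∀ (x : X) (r : ℝ), 0 < r →
      ν (Metric.closedBall x r) ≤ ENNReal.ofReal (c * (r + 0) ^ q)}.Nonempty := by
    by_contra hcon
    rw [Set.not_nonempty_iff_eq_empty] at hcon
    rw [regularNorm, hcon, Real.sInf_empty] at h
    exact lt_irrefl _ h
  have h1 : (ν (Metric.closedBall x r)).toReal / r ^ q ≤ regularNorm q 0 ν := by
    refine le_csInf hne ?_
    rintro c ⟨hc0, hc⟩
    rw [div_le_iff₀ hrq]
    have := hc x r hr
    rw [add_zero] at this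
    exact ENNReal.toReal_le_of_le_ofReal (by positivity) this
  rw [div_le_iff₀ hrq] at h1
  exact (ENNReal.le_ofReal_iff_toReal_le (measure_ne_top _ _) (by positivity)).2 h1

end

section

variable {X Ω : Type*} [MeasurableSpace X] [MeasurableSpace Ω] {τ : Measure (X × Ω)}
  {F : X × Ω → ℝ} {f : X → ℝ}

theorem integrable_of_eq_condExp (hf : Measurable f)
    (hcond : (fun z : X × Ω => f z.1) =ᵐ[τ]
      condExp (MeasurableSpace.comap Prod.fst inferInstance) τ F) :
    Integrable f (τ.map Prod.fst) :=
  (integrable_map_measure hf.aestronglyMeasurable measurable_fst.aemeasurable).2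
    (integrable_condExp.congr hcond.symm)

theorem integral_mul_eq_of_eq_condExp [IsProbabilityMeasure τ] (hF : Measurable F) (hF1 : ∀ z, |F z| ≤ 1)
    (hf : Measurable f)
    (hcond : (fun z : X × Ω => f z.1) =ᵐ[τ]
      condExp (MeasurableSpace.comap Prod.fst inferInstance) τ F)
    {g : X → ℝ} (hg : Measurable g) {D : ℝ} (hgD : ∀ x, |g x| ≤ D) :
    ∫ z, F z * g z.1 ∂τ = ∫ y, g y * f y ∂(τ.map Prod.fst) := by
  have hm : MeasurableSpace.comap (Prod.fst : X × Ω → X) inferInstance ≤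
      (inferInstance : MeasurableSpace (X × Ω)) := measurable_fst.comap_le
  have hFi : Integrable F τ := Integrable.of_bound hF.aestronglyMeasurable 1 (ae_of_all _ hF1)
  have hgi : Integrable ((fun z : X × Ω => g z.1) * F) τ :=
    hFi.bdd_mul (c := D) (hg.comp measurable_fst).aestronglyMeasurable
      (ae_of_all _ fun z => hgD z.1)
  have hgm : StronglyMeasurable[MeasurableSpace.comap (Prod.fst : X × Ω → X) inferInstance]
      (fun z : X × Ω => g z.1) :=
    (hg.comp (comap_measurable (Prod.fst : X × Ω → X))).stronglyMeasurable
  have h1 := condExp_mul_of_stronglyMeasurable_left hgm hgi hFi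
  rw [integral_map measurable_fst.aemeasurable (f := fun y => g y * f y)
    (hg.mul hf).aestronglyMeasurable]
  calc ∫ z, F z * g z.1 ∂τ = ∫ z, ((fun z : X × Ω => g z.1) * F) z ∂τ := by
        simp only [Pi.mul_apply, mul_comm]
    _ = ∫ z, condExp (MeasurableSpace.comap Prod.fst inferInstance) τ
          ((fun z : X × Ω => g z.1) * F) z ∂τ := (integral_condExp hm).symm
    _ = ∫ z, g z.1 * f z.1 ∂τ := by
        refine integral_congr_ae ?_
        filter_upwards [h1, hcond] with z hz1 hz2
        rw [hz1, Pi.mul_apply, hz2]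

end

/-- A variance reduced by the factor w yields the tail e^{-s/w}; extracting a factor w from it makes
the tail integrable over X. -/
theorem exp_neg_div_le {s w : ℝ} (hs : 2 ≤ s) (hw0 : 0 < w) (hw1 : w ≤ 1) :
    Real.exp (-(s / w)) ≤ Real.exp (-(s / 2)) * w := by
  have h1 : Real.exp (-(1 / w)) ≤ w := by
    rw [Real.exp_neg, inv_le_comm₀ (Real.exp_pos _) hw0, ← one_div]
    linarith [Real.add_one_le_exp (1 / w)]
  have h2 : s / 2 + 1 / w ≤ s / w := by
    have h3 : s / 2 ≤ s / 2 / w := le_div_self (by linarith) hw0 hw1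
    have h4 : 1 / w ≤ s / 2 / w := by gcongr; linarith
    have h5 : s / 2 / w + s / 2 / w = s / w := by ring
    linarith
  calc Real.exp (-(s / w)) ≤ Real.exp (-(s / 2) + -(1 / w)) := Real.exp_le_exp.2 (by linarith)
    _ = Real.exp (-(s / 2)) * Real.exp (-(1 / w)) := Real.exp_add _ _
    _ ≤ _ := by gcongr

namespace IsDataSpace

variable {X : Type*} [MetricSpace X] [MeasurableSpace X] [BorelSpace X] {q : ℝ} {μ : Measure X}
  {lam : ℕ → ℝ} {φ : ℕ → C₀(X, ℝ)}

/-- The pointwise concentration of the empirical sums, with a gain where the Christoffel function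
is small. -/
theorem exists_pointwise_tail (hX : IsDataSpace q μ lam φ) {h : ℝ → ℝ} (hh : IsLowPass h)
    {a : ℝ} (ha : 0 < a) :
    ∃ C : ℝ, 0 < C ∧ ∀ {Ω : Type*} [MeasurableSpace Ω] (τ : Measure (X × Ω))
      [IsProbabilityMeasure τ] (F : X × Ω → ℝ), Measurable F → (∀ z, |F z| ≤ 1) →
      ∀ R : ℝ, a ≤ R →
      (∀ (x : X) (r : ℝ), 0 < r →
        τ.map Prod.fst (Metric.closedBall x r) ≤ ENNReal.ofReal (R * r ^ q)) →
      ∀ (n t : ℝ) (M : ℕ), 1 ≤ n → 0 < t → t ≤ R → 0 < M → ∀ x : X,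
        (Measure.pi fun _ : Fin M => τ) {z | t ≤ |empirical lam φ h n F z x -
          ∫ w, F w * kern lam φ h n x w.1 ∂τ|} ≤
        ENNReal.ofReal (2 * Real.exp (-(M * t ^ 2 / (4 * (C * (n ^ q * R) *
          min 1 (n ^ (q / 2) * √(christoffel lam φ n x))))))) := by
  obtain ⟨C, hC, H⟩ := hX.exists_lintegral_kern_sq_le hh ha
  obtain ⟨D, hD, HD⟩ := hX.exists_christoffel_le
  refine ⟨C + D * √D / a + D + √D, by positivity, ?_⟩
  intro Ω _ τ _ F hF hF1 R hR hball n t M hn ht htR hM x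
  have hn0 : 0 < n := by linarith
  have hR0 : 0 < R := by linarith
  have hq : 0 < q := by linarith [hX.one_le_q]
  have hl := hX.lam_tendsto
  set G := n ^ (q / 2) * √(christoffel lam φ n x) with hG
  have hG0 : 0 < G := mul_pos (Real.rpow_pos_of_pos hn0 _)
    (Real.sqrt_pos.2 (hX.christoffel_pos hn0 x))
  set w := min 1 G with hw
  have hw0 : 0 < w := lt_min one_pos hG0
  set C' := C + D * √D / a + D + √D with hC'
  have hkm : Measurable (kern lam φ h n x) := (continuous_kern_right hl hh hn0 x).measurable
  have hsq : ∀ y, √(christoffel lam φ n y) ≤ √D * n ^ (q / 2) := by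
    intro y
    have e : √(n ^ q) = n ^ (q / 2) := by
      rw [Real.sqrt_eq_rpow, ← Real.rpow_mul hn0.le]; congr 1; ring
    rw [← e, ← Real.sqrt_mul hD.le]
    exact Real.sqrt_le_sqrt (HD n hn y)
  have hnq1 : 1 ≤ n ^ q := Real.one_le_rpow hn hq.le
  have hnqq : n ^ (q / 2) * n ^ (q / 2) = n ^ q := by
    rw [← Real.rpow_add hn0]; congr 1; ring
  have hk1 : ∀ y, |kern lam φ h n x y| ≤ √D * G := by
    intro y
    calc _ ≤ √(christoffel lam φ n x) * √(christoffel lam φ n y) := abs_kern_le hl hh hn0 x y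
      _ ≤ √(christoffel lam φ n x) * (√D * n ^ (q / 2)) := by gcongr; exact hsq y
      _ = _ := by rw [hG]; ring
  have hGn : √D * G ≤ D * n ^ q := by
    calc √D * G ≤ √D * (n ^ (q / 2) * (√D * n ^ (q / 2))) := by rw [hG]; gcongr; exact hsq x
      _ = (√D * √D) * (n ^ (q / 2) * n ^ (q / 2)) := by ring
      _ = _ := by rw [Real.mul_self_sqrt hD.le, hnqq]
  set Y : X × Ω → ℝ := fun z => F z * kern lam φ h n x z.1 with hYdef
  have hY : Measurable Y := hF.mul (hkm.comp measurable_fst)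
  have hYk : ∀ z, |Y z| ≤ |kern lam φ h n x z.1| := fun z => by
    rw [hYdef, abs_mul]
    exact mul_le_of_le_one_left (abs_nonneg _) (hF1 z)
  have hYβ : ∀ z, |Y z| ≤ √D * G := fun z => (hYk z).trans (hk1 z.1)
  have hCD : 0 < D * √D / a := by positivity
  have hsD : 0 < √D := Real.sqrt_pos.2 hD
  have hprob : IsProbabilityMeasure (τ.map Prod.fst) :=
    Measure.isProbabilityMeasure_map measurable_fst.aemeasurable
  have hV1 : ∫ z, Y z ^ 2 ∂τ ≤ C' * (n ^ q * R) := by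
    rw [integral_eq_lintegral_of_nonneg_ae (ae_of_all _ fun z => sq_nonneg _)
      (hY.pow_const 2).aestronglyMeasurable]
    refine ENNReal.toReal_le_of_le_ofReal (by positivity) ?_
    calc _ ≤ ∫⁻ z, ENNReal.ofReal (kern lam φ h n x z.1 ^ 2) ∂τ := by
          exact lintegral_mono fun z => ENNReal.ofReal_le_ofReal (sq_le_sq.2 (hYk z))
      _ = ∫⁻ y, ENNReal.ofReal (kern lam φ h n x y ^ 2) ∂(τ.map Prod.fst) :=
          (lintegral_map (hkm.pow_const 2).ennreal_ofReal measurable_fst).symm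
      _ ≤ ENNReal.ofReal (C * (n ^ q * R)) := H _ R hR hball n hn x
      _ ≤ _ := by
          apply ENNReal.ofReal_le_ofReal
          gcongr
          linarith
  -- The gain: both √D·G and D·n^q bound |Y|, so their product bounds Y². The factor R enters
  -- through R/a ≥ 1.
  have hV2 : ∫ z, Y z ^ 2 ∂τ ≤ C' * (n ^ q * R) * G := by
    have h1 : ∀ z, Y z ^ 2 ≤ C' * (n ^ q * R) * G := by
      intro z
      have hRa : 1 ≤ R / a := (one_le_div ha).2 hR
      calc Y z ^ 2 = |Y z| * |Y z| := by rw [← sq_abs, pow_two]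
        _ ≤ (√D * G) * (D * n ^ q) :=
            mul_le_mul (hYβ z) ((hYβ z).trans hGn) (abs_nonneg _) (by positivity)
        _ = (√D * D) * n ^ q * G * 1 := by ring
        _ ≤ (√D * D) * n ^ q * G * (R / a) := by gcongr
        _ = (D * √D / a) * (n ^ q * R) * G := by ring
        _ ≤ _ := by gcongr; linarith
    calc _ ≤ ∫ z, C' * (n ^ q * R) * G ∂τ :=
          integral_mono_of_nonneg (ae_of_all _ fun z => sq_nonneg _) (integrable_const _)
            (ae_of_all _ h1)
      _ = _ := by simp
  have hV : ∫ z, Y z ^ 2 ∂τ ≤ C' * (n ^ q * R) * w := by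
    rcases min_choice 1 G with hc | hc
    · rw [hw, hc, mul_one]; exact hV1
    · rw [hw, hc]; exact hV2
  have htβ : t * (√D * G) ≤ 2 * (C' * (n ^ q * R) * w) := by
    have h1 : √D * G ≤ C' * n ^ q * w := by
      rcases min_choice 1 G with hc | hc
      · rw [hw, hc, mul_one]
        refine hGn.trans ?_
        gcongr
        linarith
      · rw [hw, hc]
        gcongr
        calc √D ≤ C' * 1 := by linarith
          _ ≤ _ := by gcongr
    calc t * (√D * G) ≤ R * (C' * n ^ q * w) := by gcongr
      _ = C' * (n ^ q * R) * w := by ring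
      _ ≤ _ := by
        have : 0 < C' * (n ^ q * R) * w := by positivity
        linarith
  exact pi_abs_mean_sub_ge_le hY hYβ hV (by positivity) ht htβ hM

theorem exists_lintegral_tail_weight_le (hX : IsDataSpace q μ lam φ) :
    ∃ (C : ℝ) (p : ℕ), 0 < C ∧ ∀ n : ℝ, 1 ≤ n →
      ∫⁻ x, ENNReal.ofReal (min 1 (n ^ (q / 2) * √(christoffel lam φ n x))) ∂μ ≤
        ENNReal.ofReal (C * n ^ p) := by
  obtain ⟨C, A, hC, H⟩ := hX.exists_lintegral_sqrt_christoffel_le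
  refine ⟨C, A + ⌈q / 2⌉₊, hC, fun n hn => ?_⟩
  have hn0 : 0 < n := by linarith
  calc _ ≤ ∫⁻ x, ENNReal.ofReal (n ^ (q / 2)) * ENNReal.ofReal √(christoffel lam φ n x) ∂μ := by
        gcongr with x
        rw [← ENNReal.ofReal_mul (by positivity)]
        exact ENNReal.ofReal_le_ofReal (min_le_right _ _)
    _ = ENNReal.ofReal (n ^ (q / 2)) * ∫⁻ x, ENNReal.ofReal √(christoffel lam φ n x) ∂μ :=
        lintegral_const_mul' _ _ ENNReal.ofReal_ne_top
    _ ≤ ENNReal.ofReal (n ^ (q / 2)) * ENNReal.ofReal (C * n ^ A) := by gcongr; exact H n hn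
    _ ≤ _ := by
        rw [← ENNReal.ofReal_mul (by positivity)]
        apply ENNReal.ofReal_le_ofReal
        have h1 : n ^ (q / 2) ≤ n ^ ⌈q / 2⌉₊ := by
          rw [← Real.rpow_natCast]
          exact Real.rpow_le_rpow_of_exponent_le hn (Nat.le_ceil _)
        calc _ ≤ n ^ ⌈q / 2⌉₊ * (C * n ^ A) := by gcongr
          _ = _ := by ring

/-- The deviation of the empirical sums is a diffusion polynomial with random coefficients. -/
theorem empirical_sub_sigmaOp (hX : IsDataSpace q μ lam φ) {h : ℝ → ℝ} (hh : IsLowPass h)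
    {n : ℝ} (hn : 0 < n) {Ω : Type*} (F : X × Ω → ℝ) {M : ℕ} (z : Fin M → X × Ω)
    {ν : Measure X} {f : X → ℝ} (hf : Integrable f ν) (x : X) :
    empirical lam φ h n F z x - sigmaOp lam φ h n ν f x =
      ∑ k ∈ lowIndices hX.lam_tendsto n, (h (lam k / n) *
        (1 / (M : ℝ) * ∑ j, F (z j) * φ k (z j).1 - ∫ y, φ k y * f y ∂ν)) * φ k x := by
  have hl := hX.lam_tendsto
  have h1 : empirical lam φ h n F z x = ∑ k ∈ lowIndices hl n,
      h (lam k / n) * (1 / (M : ℝ) * ∑ j, F (z j) * φ k (z j).1) * φ k x := by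
    simp_rw [empirical, kern_eq_sum hl hh hn, Finset.mul_sum, Finset.sum_mul]
    rw [Finset.sum_comm]
    refine Finset.sum_congr rfl fun k _ => Finset.sum_congr rfl fun j _ => ?_
    ring
  have h2 : sigmaOp lam φ h n ν f x = ∑ k ∈ lowIndices hl n,
      h (lam k / n) * (∫ y, φ k y * f y ∂ν) * φ k x := by
    have hi : ∀ k, Integrable (fun y => φ k y * f y) ν := fun k =>
      hf.bdd_mul (c := ‖φ k‖) (φ k).continuous.aestronglyMeasurable
        (ae_of_all _ fun x => (φ k).toBCF.norm_coe_le_norm x)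
    have e : ∀ y, kern lam φ h n x y * f y =
        ∑ k ∈ lowIndices hl n, h (lam k / n) * φ k x * (φ k y * f y) := by
      intro y
      rw [kern_eq_sum hl hh hn, Finset.sum_mul]
      exact Finset.sum_congr rfl fun k _ => by ring
    simp_rw [sigmaOp, e]
    rw [integral_finsetSum _ fun k _ => (hi k).const_mul _]
    refine Finset.sum_congr rfl fun k _ => ?_
    rw [integral_const_mul]
    ring
  rw [h1, h2, ← Finset.sum_sub_distrib]
  exact Finset.sum_congr rfl fun k _ => by ring

end IsDataSpace

namespace IsDataSpace

variable {X : Type*} [MetricSpace X] [MeasurableSpace X] [BorelSpace X] {q : ℝ} {μ : Measure X}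
  [SigmaFinite μ] {lam : ℕ → ℝ} {φ : ℕ → C₀(X, ℝ)}

/-- Concentration of the empirical sums in the uniform norm, in terms of the level `ℓ` of the
deviation. -/
theorem exists_uniform_tail (hX : IsDataSpace q μ lam φ) {h : ℝ → ℝ} (hh : IsLowPass h)
    {a : ℝ} (ha : 0 < a) :
    ∃ (L C D : ℝ) (p : ℕ), 0 < L ∧ 0 < C ∧ 0 < D ∧
      ∀ {Ω : Type*} [MeasurableSpace Ω] (τ : Measure (X × Ω))
      [IsProbabilityMeasure τ] (F : X × Ω → ℝ) (f : X → ℝ), Measurable F → (∀ z, |F z| ≤ 1) →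
      Measurable f →
      (fun z : X × Ω => f z.1) =ᵐ[τ] condExp (MeasurableSpace.comap Prod.fst inferInstance) τ F →
      ∀ R : ℝ, a ≤ R →
      (∀ (x : X) (r : ℝ), 0 < r →
        τ.map Prod.fst (Metric.closedBall x r) ≤ ENNReal.ofReal (R * r ^ q)) →
      ∀ (n t s : ℝ) (M : ℕ), 1 ≤ n → 0 < t → t ≤ R → 0 < M → 2 ≤ s →
        s * (C * (n ^ q * R)) ≤ M * t ^ 2 →
        (Measure.pi fun _ : Fin M => τ) {z | ∃ x, L * t < |empirical lam φ h n F z x -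
          sigmaOp lam φ h n (τ.map Prod.fst) f x|} ≤
        ENNReal.ofReal (D * n ^ p * Real.exp (-(s / 2))) := by
  obtain ⟨L, C₁, hL, hC₁, HL⟩ := hX.exists_sup_le_of_measure_le hh
  obtain ⟨C₂, hC₂, HT⟩ := hX.exists_pointwise_tail hh ha
  obtain ⟨C₃, p, hC₃, HW⟩ := hX.exists_lintegral_tail_weight_le
  refine ⟨2 * L, 4 * C₂, 4 * C₁ * C₃, ⌈q⌉₊ + p, by positivity, by positivity, by positivity, ?_⟩
  intro Ω _ τ _ F f hF hF1 hf hcond R hR hball n t s M hn ht htR hM hs hsM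
  have hn0 : 0 < n := by linarith
  have hR0 : 0 < R := by linarith
  have hl := hX.lam_tendsto
  have hfi := integrable_of_eq_condExp hf hcond
  set α : (Fin M → X × Ω) → ℕ → ℝ := fun z k => h (lam k / n) *
    (1 / (M : ℝ) * ∑ j, F (z j) * φ k (z j).1 - ∫ y, φ k y * f y ∂(τ.map Prod.fst)) with hα
  set P : (Fin M → X × Ω) → X → ℝ := fun z x => ∑ k ∈ lowIndices hl n, α z k * φ k x with hP
  have hPeq : ∀ z x, empirical lam φ h n F z x - sigmaOp lam φ h n (τ.map Prod.fst) f x = P z x :=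
    fun z x => hX.empirical_sub_sigmaOp hh hn0 F z hfi x
  have hαm : ∀ k, Measurable fun z => α z k := by
    intro k
    refine Measurable.const_mul (Measurable.sub_const (Measurable.const_mul ?_ _) _) _
    refine Finset.measurable_fun_sum _ fun j _ => ?_
    exact (hF.comp (measurable_pi_apply j)).mul
      ((φ k).continuous.measurable.comp (measurable_fst.comp (measurable_pi_apply j)))
  have hPm : Measurable fun zx : (Fin M → X × Ω) × X => P zx.1 zx.2 := by
    refine Finset.measurable_fun_sum _ fun k _ => ?_
    exact ((hαm k).comp measurable_fst).mul ((φ k).continuous.measurable.comp measurable_snd)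
  set U : Set ((Fin M → X × Ω) × X) := {zx | t ≤ |P zx.1 zx.2|} with hU
  have hUm : MeasurableSet U := measurableSet_le measurable_const hPm.abs
  set π := Measure.pi fun _ : Fin M => τ with hπ
  have hH : Measurable fun z => ENNReal.ofReal (C₁ * n ^ q) * μ (Prod.mk z ⁻¹' U) :=
    (measurable_measure_prodMk_left hUm).const_mul _
  -- A large deviation at one point forces {|P| ≥ t} to have μ-measure at least of order n^{-q}. The
  -- larger event is measurable and suits Markov's inequality.
  have hsub : {z | ∃ x, 2 * L * t < |empirical lam φ h n F z x -
      sigmaOp lam φ h n (τ.map Prod.fst) f x|} ⊆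
      {z | ENNReal.ofReal (1 / 2) ≤ ENNReal.ofReal (C₁ * n ^ q) * μ (Prod.mk z ⁻¹' U)} := by
    rintro z ⟨x, hx⟩
    rw [hPeq] at hx
    by_contra hcon
    simp only [Set.mem_ofPred_eq, not_le] at hcon
    exact absurd (HL n (α z) t hn ht.le hcon.le x) (not_le.2 hx)
  have htail : ∀ x, π ((fun z => (z, x)) ⁻¹' U) ≤ ENNReal.ofReal (2 * Real.exp (-(s / 2))) *
      ENNReal.ofReal (min 1 (n ^ (q / 2) * √(christoffel lam φ n x))) := by
    intro x
    set w := min 1 (n ^ (q / 2) * √(christoffel lam φ n x)) with hw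
    have hw0 : 0 < w := lt_min one_pos (mul_pos (Real.rpow_pos_of_pos hn0 _)
      (Real.sqrt_pos.2 (hX.christoffel_pos hn0 x)))
    have hmean : ∫ z, F z * kern lam φ h n x z.1 ∂τ =
        sigmaOp lam φ h n (τ.map Prod.fst) f x := by
      obtain ⟨E, -, HE⟩ := hX.exists_abs_kern_le hh
      exact integral_mul_eq_of_eq_condExp hF hF1 hf hcond
        (continuous_kern_right hl hh hn0 x).measurable (HE n hn x)
    have h1 := HT τ F hF hF1 R hR hball n t M hn ht htR hM x
    rw [hmean] at h1
    have hset : (fun z => (z, x)) ⁻¹' U = {z | t ≤ |empirical lam φ h n F z x -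
        sigmaOp lam φ h n (τ.map Prod.fst) f x|} := by
      ext z
      simp only [hU, Set.mem_preimage, Set.mem_ofPred_eq, hPeq]
    rw [hset]
    refine h1.trans ?_
    rw [← ENNReal.ofReal_mul (by positivity)]
    apply ENNReal.ofReal_le_ofReal
    have h2 : s / w ≤ M * t ^ 2 / (4 * (C₂ * (n ^ q * R) * w)) := by
      rw [div_le_div_iff₀ hw0 (by positivity)]
      calc s * (4 * (C₂ * (n ^ q * R) * w)) = (s * (4 * C₂ * (n ^ q * R))) * w := by ring
        _ ≤ _ := by gcongr
    calc _ ≤ 2 * Real.exp (-(s / w)) := by gcongr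
      _ ≤ 2 * (Real.exp (-(s / 2)) * w) := by
        gcongr; exact exp_neg_div_le hs hw0 (min_le_left _ _)
      _ = _ := by ring
  have hmarkov := mul_meas_ge_le_lintegral (μ := π) hH (ENNReal.ofReal (1 / 2))
  have hint : ∫⁻ z, ENNReal.ofReal (C₁ * n ^ q) * μ (Prod.mk z ⁻¹' U) ∂π ≤
      ENNReal.ofReal (C₁ * n ^ q * (2 * Real.exp (-(s / 2)) * (C₃ * n ^ p))) := by
    rw [lintegral_const_mul' _ _ ENNReal.ofReal_ne_top, ← Measure.prod_apply hUm,
      Measure.prod_apply_symm hUm, ENNReal.ofReal_mul (p := C₁ * n ^ q) (by positivity)]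
    gcongr
    calc _ ≤ ∫⁻ x, ENNReal.ofReal (2 * Real.exp (-(s / 2))) *
          ENNReal.ofReal (min 1 (n ^ (q / 2) * √(christoffel lam φ n x))) ∂μ := lintegral_mono htail
      _ ≤ ENNReal.ofReal (2 * Real.exp (-(s / 2))) * ENNReal.ofReal (C₃ * n ^ p) := by
        rw [lintegral_const_mul' _ _ ENNReal.ofReal_ne_top]
        gcongr
        exact HW n hn
      _ = _ := (ENNReal.ofReal_mul (by positivity)).symm
  have h3 := (mul_le_mul_right (measure_mono (μ := π) hsub) (ENNReal.ofReal (1 / 2))).trans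
    (hmarkov.trans hint)
  have e2 : ENNReal.ofReal 2 * ENNReal.ofReal (1 / 2) = 1 := by
    rw [← ENNReal.ofReal_mul (by norm_num)]; norm_num
  refine le_trans (le_of_eq ?_) ((mul_le_mul_right h3 (ENNReal.ofReal 2)).trans ?_)
  · rw [← mul_assoc, e2, one_mul]
  · rw [← ENNReal.ofReal_mul (by norm_num)]
    apply ENNReal.ofReal_le_ofReal
    have h1 : n ^ q ≤ n ^ ⌈q⌉₊ := by
      rw [← Real.rpow_natCast]
      exact Real.rpow_le_rpow_of_exponent_le hn (Nat.le_ceil _)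
    calc _ = 4 * C₁ * C₃ * (n ^ q * n ^ p) * Real.exp (-(s / 2)) := by ring
      _ ≤ 4 * C₁ * C₃ * (n ^ ⌈q⌉₊ * n ^ p) * Real.exp (-(s / 2)) := by gcongr
      _ = _ := by rw [pow_add]

end IsDataSpace

/-- The arithmetic of the constants: the deviation `t` and the exponent `s` determined by the sample
size. -/
theorem deviation_parameters {a b T c n N B R δ m : ℝ} (ha : 0 < a) (hT : 0 < T)
    (hc3 : 3 ≤ c * b) (hca : 3 ≤ c * b * a) (hc : 0 < c)
    (hn : 1 ≤ n) (hB : b ≤ B) (hR : a ≤ R) (hδ : 0 < δ) (hδ1 : δ < 1) (hN : 0 < N)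
    (hm : T * (1 / a ^ 2 + 1 / a) * N * R * Real.log (c * n * B / δ) ≤ m) :
    1 ≤ Real.log (c * n * B * R / δ) ∧ 0 < m ∧
      √(T * (N * R * Real.log (c * n * B * R / δ) / m)) ≤ R := by
  have hR0 : 0 < R := by linarith
  have hn0 : 0 < n := by linarith
  have hlog3 : 1 ≤ Real.log 3 := by
    rw [Real.le_log_iff_exp_le (by norm_num)]
    linarith [Real.exp_one_lt_d9]
  have hb0 : 0 < c * b := by linarith
  have hcnB : c * b ≤ c * n * B / δ := by
    rw [le_div_iff₀ hδ]
    have h1 : 0 < b := pos_of_mul_pos_right hb0 hc.le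
    calc c * b * δ ≤ c * b * 1 := by gcongr
      _ = c * 1 * b := by ring
      _ ≤ c * n * B := by gcongr
  have hQ : 3 ≤ c * n * B * R / δ := by
    calc 3 ≤ c * b * a := hca
      _ ≤ c * n * B / δ * R := mul_le_mul hcnB hR ha.le (hb0.le.trans hcnB)
      _ = _ := by ring
  have hl1 : 1 ≤ Real.log (c * n * B / δ) :=
    hlog3.trans (Real.log_le_log (by norm_num) (hc3.trans hcnB))
  have hl2 : 1 ≤ Real.log (c * n * B * R / δ) :=
    hlog3.trans (Real.log_le_log (by norm_num) hQ)
  set ℓ := Real.log (c * n * B / δ) with hℓ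
  have hm0 : 0 < m := lt_of_lt_of_le (by positivity) hm
  refine ⟨hl2, hm0, ?_⟩
  rw [Real.sqrt_le_left hR0.le]
  -- The sample size is stated with log(cnB/δ), the deviation with an extra R inside. The excess log
  -- R ≤ R - 1 is paid by the factor R² on the right, which is why 1/a² + 1/a enters the sample-size
  -- constant.
  have hlog : Real.log (c * n * B * R / δ) ≤ ℓ * (1 + R) := by
    have e : c * n * B * R / δ = (c * n * B / δ) * R := by ring
    rw [e, Real.log_mul (by linarith) hR0.ne', ← hℓ]
    have := Real.log_le_sub_one_of_pos hR0
    nlinarith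
  have h1R : 1 + R ≤ (1 / a ^ 2 + 1 / a) * R ^ 2 := by
    have h1 : 1 ≤ R / a := (one_le_div ha).2 hR
    have e : (1 / a ^ 2 + 1 / a) * R ^ 2 = (R / a) * (R / a) + R * (R / a) := by
      field_simp
    rw [e]
    nlinarith
  rw [← mul_div_assoc, div_le_iff₀ hm0]
  calc T * (N * R * Real.log (c * n * B * R / δ)) ≤ T * (N * R * (ℓ * (1 + R))) := by gcongr
    _ ≤ T * (N * R * (ℓ * ((1 / a ^ 2 + 1 / a) * R ^ 2))) := by gcongr
    _ = R ^ 2 * (T * (1 / a ^ 2 + 1 / a) * N * R * ℓ) := by ring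
    _ ≤ R ^ 2 * m := by gcongr

/-- The exponential is Q^{-(p+1)}: p factors absorb n^p since Q ≥ n, and the last gives δ/R since Q
≥ DR/δ. -/
theorem tail_level_le {a b D c n B R δ : ℝ} {p : ℕ} (ha : 0 < a) (hb : 0 < b)
    (hca : 3 ≤ c * b * a) (hcD : D ≤ c * b) (hc : 0 < c) (hD : 0 < D)
    (hn : 1 ≤ n) (hB : b ≤ B) (hR : a ≤ R) (hδ : 0 < δ) (hδ1 : δ < 1) :
    D * n ^ p * Real.exp (-((2 * (p + 1) * Real.log (c * n * B * R / δ)) / 2)) ≤ δ / R := by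
  have hR0 : 0 < R := by linarith
  have hn0 : 0 < n := by linarith
  have hB0 : 0 < B := by linarith
  set Q := c * n * B * R / δ with hQ
  have hQ0 : 0 < Q := by positivity
  have hexp : Real.exp (-((2 * (p + 1) * Real.log Q) / 2)) = 1 / (Q ^ p * Q) := by
    have : -((2 * ((p : ℝ) + 1) * Real.log Q) / 2) = -(((p + 1 : ℕ) : ℝ) * Real.log Q) := by
      push_cast; ring
    rw [this, Real.exp_neg, Real.exp_nat_mul, Real.exp_log hQ0, pow_succ, one_div]
  have hQn : n ≤ Q := by
    rw [hQ, le_div_iff₀ hδ]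
    have h1 : 1 ≤ c * B * R := by
      calc 1 ≤ c * b * a := by linarith
        _ ≤ _ := by gcongr
    calc n * δ ≤ n * 1 := by gcongr
      _ ≤ n * (c * B * R) := by gcongr
      _ = _ := by ring
  have hQD : D * (R / δ) ≤ Q := by
    calc D * (R / δ) ≤ (c * b) * (R / δ) := by gcongr
      _ = c * 1 * b * R / δ := by ring
      _ ≤ Q := by rw [hQ]; gcongr
  rw [hexp, mul_one_div, div_le_div_iff₀ (by positivity) hR0]
  calc D * n ^ p * R = n ^ p * (D * (R / δ)) * δ := by field_simp
    _ ≤ Q ^ p * Q * δ := by gcongr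
    _ = _ := by ring

end DataSpace

end

/-! ### Choice of the constants and conclusion. -/

theorem theorem8p1
    {X : Type*} [MetricSpace X] [ConnectedSpace X] [MeasurableSpace X] [BorelSpace X]
    (q : ℝ) (μ : Measure X) [SigmaFinite μ] (lam : ℕ → ℝ) (φ : ℕ → C₀(X, ℝ))
    (hX : DataSpace.IsDataSpace q μ lam φ)
    (h : ℝ → ℝ) (hh : DataSpace.IsLowPass h)
    (a b : ℝ) (ha : 0 < a) (hb : 0 < b) :
    ∃ c c₁ c₃ : ℝ, 0 < c ∧ 0 < c₁ ∧ 0 < c₃ ∧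
      ∀ (B : ℝ → ℝ), DataSpace.BernsteinLipschitz μ lam φ B →
      ∀ (Ω : Type*) [MeasurableSpace Ω] (f₀ : C₀(X, ℝ)) (νs : Measure X)
        (τ : Measure (X × Ω)) (F : X × Ω → ℝ) (f : X → ℝ),
        (∀ x, 0 ≤ f₀ x) →
        νs = DataSpace.densityMeasure μ f₀ →
        IsProbabilityMeasure νs →
        τ.map Prod.fst = νs →
        Measurable F →
        (∀ y ε, |F (y, ε)| ≤ 1) →
        Measurable f →
        (fun z : X × Ω => f z.1) =ᵐ[τ]
          condExp (MeasurableSpace.comap Prod.fst inferInstance) τ F →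
        a ≤ DataSpace.regularNorm q 0 νs →
        ∀ (n δ : ℝ) (M : ℕ), 1 ≤ n → b ≤ B n → 0 < δ → δ < 1 →
          c₁ * n ^ q * DataSpace.regularNorm q 0 νs * Real.log (c * n * B n / δ) ≤ (M : ℝ) →
          Measure.pi (fun _ : Fin M => τ)
              {z | ENNReal.ofReal (c₃ * Real.sqrt (n ^ q * DataSpace.regularNorm q 0 νs *
                      Real.log (c * n * B n * DataSpace.regularNorm q 0 νs / δ) / (M : ℝ))) ≤
                    eLpNorm (fun x => DataSpace.empirical lam φ h n F z x -
                      DataSpace.sigmaOp lam φ h n νs f x) ∞ μ} ≤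
            ENNReal.ofReal (δ / DataSpace.regularNorm q 0 νs) := by
  obtain ⟨L, C, D, p, hL, hC, hD, H⟩ := hX.exists_uniform_tail hh ha
  -- The three summands give cb ≥ 3 and cba ≥ 3, making both logarithms at least 1, and cb ≥ D.
  obtain ⟨c, hc⟩ : ∃ c, c = (3 + 3 / a + D) / b := ⟨_, rfl⟩
  have hcb : c * b = 3 + 3 / a + D := by rw [hc]; field_simp
  have hc0 : 0 < c := by rw [hc]; positivity
  have h3a : 0 < 3 / a := by positivity
  have hca : 3 ≤ c * b * a := by
    have e : 3 / a * a = 3 := by field_simp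
    have : 0 < (3 + D) * a := by positivity
    rw [hcb]; linarith
  set T : ℝ := 2 * (p + 1) * C with hT
  have hT0 : 0 < T := by positivity
  -- T makes t² equal to the deviation required by s = 2(p+1)ℓ. The added 1 in c₃ bridges the
  -- non-strict event of the theorem and the strict one of the uniform tail.
  refine ⟨c, T * (1 / a ^ 2 + 1 / a), L * √T + 1, hc0, by positivity, by positivity, ?_⟩
  intro B _ Ω _ f₀ νs τ F f _ _ hprob hmap hF hF1 hf hcond hR n δ M hn hB hδ hδ1 hM
  set R := DataSpace.regularNorm q 0 νs with hRdef
  have hR0 : 0 < R := by linarith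
  have hn0 : 0 < n := by linarith
  have hτ : IsProbabilityMeasure τ := by
    constructor
    have := hprob.measure_univ
    rwa [← hmap, Measure.map_apply measurable_fst MeasurableSet.univ, Set.preimage_univ] at this
  have hball : ∀ (x : X) (r : ℝ), 0 < r →
      τ.map Prod.fst (Metric.closedBall x r) ≤ ENNReal.ofReal (R * r ^ q) := by
    intro x r hr
    rw [hmap]
    exact DataSpace.measure_closedBall_le_regularNorm hR0 x hr
  obtain ⟨hl1, hm0, htR⟩ := DataSpace.deviation_parameters (N := n ^ q) ha hT0
    (by rw [hcb]; linarith) hca hc0 hn hB hR hδ hδ1 (Real.rpow_pos_of_pos hn0 q) hM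
  set ℓ := Real.log (c * n * B n * R / δ) with hℓ
  have hσ0 : 0 < n ^ q * R * ℓ / M := by positivity
  set t := √(T * (n ^ q * R * ℓ / M)) with ht
  have ht0 : 0 < t := Real.sqrt_pos.2 (by positivity)
  have hts : t = √T * √(n ^ q * R * ℓ / M) := Real.sqrt_mul hT0.le _
  have hs2 : 2 ≤ 2 * ((p : ℝ) + 1) * ℓ := by
    have : (0 : ℝ) ≤ p := Nat.cast_nonneg p
    nlinarith
  have hsM : 2 * ((p : ℝ) + 1) * ℓ * (C * (n ^ q * R)) ≤ M * t ^ 2 := by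
    rw [ht, Real.sq_sqrt (by positivity), hT]
    apply le_of_eq
    field_simp
  have hmain := H τ F f hF (fun z => hF1 z.1 z.2) hf hcond R hR hball n t
    (2 * ((p : ℝ) + 1) * ℓ) M hn ht0 htR (by exact_mod_cast hm0) hs2 hsM
  rw [hmap] at hmain
  refine (measure_mono ?_).trans (hmain.trans (ENNReal.ofReal_le_ofReal
    (DataSpace.tail_level_le ha hb hca (by rw [hcb]; linarith) hc0 hD hn hB hR hδ hδ1)))
  intro z hz
  by_contra hcon
  simp only [Set.mem_ofPred_eq, not_exists, not_lt] at hz hcon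
  have h1 : eLpNorm (fun x => DataSpace.empirical lam φ h n F z x -
      DataSpace.sigmaOp lam φ h n νs f x) ∞ μ ≤ ENNReal.ofReal (L * t) := by
    rw [eLpNorm_exponent_top]
    exact eLpNormEssSup_le_of_ae_bound (ae_of_all _ hcon)
  have h2 := (ENNReal.ofReal_le_ofReal_iff (by positivity)).1 (hz.trans h1)
  have h3 : 0 < √(n ^ q * R * ℓ / M) := Real.sqrt_pos.2 hσ0
  rw [hts] at h2
  nlinarith
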